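/- Let $m,r\ge 0$ be integers and $\mathfrak g=\mathfrak{gl}_m(\mathbb C)$. Let $\hat{\mathfrak g}_r=\mathfrak g[z]/z^{r+1}\mathfrak g[z]$ be the Takiff algebra, and let $\hat G_r=\{g_0+g_1z+\dots+g_rz^r : g_0\in GL_m(\mathbb C),\ g_i\in\mathfrak g\}$ with multiplication mod $z^{r+1}$ be its group. Identify the dual $\hat{\mathfrak g}_r^\star$ with $\{\sum_{i=0}^r A_iz^{-i-1} : A_i\in\mathfrak g\}$ by $\langle A,B\rangle=\operatorname{Res}_{z=0}\operatorname{Tr}(A(z)B(z))\,dz=\sum_i\operatorname{Tr}(A_iB_i)$. Let $\pi_-$ be the projection of Laurent polynomials in $z$ to their part with negative exponents. The coadjoint action is $\operatorname{Ad}^*_gA=\pi_-[gAg^{-1}]$, with infinitesimal action $\operatorname{ad}^*_\xi A=\pi_-[\xi A-A\xi]$. Each coadjoint orbit carries the Kirillov–Kostant–Souriau form $\omega_{KKS}(\operatorname{ad}^*_\xi A,\operatorname{ad}^*_\eta A)=-\langle A,[\xi,\eta]\rangle$. Let $T^\star\hat{\mathfrak g}_r$ be the space of pairs $(Q,P)$,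 $Q=\sum_{i=0}^rQ_iz^i$, $P=\sum_{i=0}^rP_iz^{-i-1}$, $Q_i,P_i\in\mathfrak g$, with the symplectic form $\omega=d\langle P,dQ\rangle=\sum_i\operatorname{Tr}(dP_i\wedge dQ_i)$ and the inner action $g\cdot(Q,P)=(Qg^{-1}\bmod z^{r+1},\ \pi_-[gP])$ of $\hat G_r$. Put $\Lambda(z)=\pi_-[PQ]$ and $A(z)=\pi_-[QP]$. 1. The inner action is Hamiltonian: it preserves $\omega$, it has moment map $(Q,P)\mapsto\Lambda$, and this map is equivariant. 2. Explicitly, $A(z)=\sum_{k=0}^rA_kz^{-k-1}$ and $\Lambda(z)=\sum_{k=0}^r\Lambda_kz^{-k-1}$ with $$A_k=\sum_{i=0}^{r-k}Q_iP_{i+k},\qquad \Lambda_k=\sum_{i=0}^{r-k}P_{i+k}Q_i .$$ 3. Let $\Lambda_0(z)\in\hat{\mathfrak g}_r^\star$ be arbitrary, and let $\hat{\mathcal O}_r^\star\subset\hat{\mathfrak g}_r^\star$ be its coadjoint orbit. Let $$T^\star\hat{\mathfrak g}_r/\!/_{\Lambda_0}\hat G_r=\{(Q,P):\pi_-[PQ]=\Lambda_0\}/\operatorname{Stab}_{\hat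 G_r}(\Lambda_0)$$ be the Hamiltonian reduction with respect to the inner action. It carries the quotient Zariski topology; its regular functions are the functions whose pull-back to the level set is regular, and its reduced form is the form whose pull-back to the level set is the restriction of $\omega$. The map $(Q,P)\mapsto A(z)=\pi_-[QP]$ is well defined on the reduction, and it is a rational symplectomorphism onto $\hat{\mathcal O}_r^\star$ in the following sense. Let $D$ be either the subset of the reduction where $Q(z)$ is invertible (that is, $\det Q_0\ne0$), or the subset where $z^{r+1}P(z)$ is invertible (that is, $\det P_r\ne0$). Then $D$ is Zariski open and non-empty, and the moment map is submersive at the points of the level set over $D$. The map restricts to a biregular bijection of $D$ onto the whole orbit $\hat{\mathcal O}_r^\star$; in particular $A(z)$ and $\Lambda_0(z)$ lie in the same coadjoint orbit. At each point of $D$ its differential is an isomorphism of the reduced tangent space onto the tangent space of $\hat{\mathcal O}_r^\star$ that carries the reduced form to $\omega_{KKS}$, and both forms are non-degenerate. If the leading coefficient $\Lambda_r$ of $\Lambda_0(z)$ (the coefficient of $z^{-r-1}$) is an invertible matrix, then each of the two sets $D$ is the whole reduction. -/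

import Mathlib

noncomputable section

namespace TakiffReduction

/-! ### The Takiff algebra, its dual and its group -/

/-- The associative algebra underlying `𝔤 = 𝔤𝔩_m(ℂ)`. -/
abbrev Mat (m : ℕ) : Type := Matrix (Fin m) (Fin m) ℂ

/-- Elements `∑ i ≤ r, B i * z ^ i` of the Takiff algebra of degree `r` of `𝔤𝔩_m`,
given by their coefficients. -/
def Takiff (m r : ℕ) : Type := Fin (r + 1) → Mat m

/-- Elements `∑ i ≤ r, A i * z ^ (-i-1)` of the dual of the Takiff algebra, given by their
coefficients. -/
def TakiffDual (m r : ℕ) : Type := Fin (r + 1) → Mat m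

variable {m r : ℕ}

instance : AddCommGroup (Takiff m r) := inferInstanceAs (AddCommGroup (Fin (r + 1) → Mat m))
instance : Module ℂ (Takiff m r) := inferInstanceAs (Module ℂ (Fin (r + 1) → Mat m))
instance : TopologicalSpace (Takiff m r) :=
  inferInstanceAs (TopologicalSpace (Fin (r + 1) → Mat m))
instance : AddCommGroup (TakiffDual m r) := inferInstanceAs (AddCommGroup (Fin (r + 1) → Mat m))
instance : Module ℂ (TakiffDual m r) := inferInstanceAs (Module ℂ (Fin (r + 1) → Mat m))
instance : TopologicalSpace (TakiffDual m r) :=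
  inferInstanceAs (TopologicalSpace (Fin (r + 1) → Mat m))

/-- The coefficient of `z ^ i`. -/
def Takiff.coeff (g : Takiff m r) (i : Fin (r + 1)) : Mat m := g i

/-- The coefficient of `z ^ (-i-1)`. -/
def TakiffDual.coeff (A : TakiffDual m r) (i : Fin (r + 1)) : Mat m := A i

@[ext] theorem Takiff.ext {g h : Takiff m r} (e : ∀ i, g.coeff i = h.coeff i) : g = h := funext e

@[ext] theorem TakiffDual.ext {A B : TakiffDual m r} (e : ∀ i, A.coeff i = B.coeff i) : A = B :=
  funext e

@[simp] theorem Takiff.coeff_add (g h : Takiff m r) (i : Fin (r + 1)) :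
    (g + h).coeff i = g.coeff i + h.coeff i := rfl
@[simp] theorem Takiff.coeff_smul (c : ℂ) (g : Takiff m r) (i : Fin (r + 1)) :
    (c • g).coeff i = c • g.coeff i := rfl
@[simp] theorem Takiff.coeff_zero (i : Fin (r + 1)) : (0 : Takiff m r).coeff i = 0 := rfl
@[simp] theorem TakiffDual.coeff_add (g h : TakiffDual m r) (i : Fin (r + 1)) :
    (g + h).coeff i = g.coeff i + h.coeff i := rfl
@[simp] theorem TakiffDual.coeff_smul (c : ℂ) (g : TakiffDual m r) (i : Fin (r + 1)) :
    (c • g).coeff i = c • g.coeff i := rfl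

/-- Matrix valued Laurent polynomials in the spectral parameter `z`. -/
abbrev MatLaurent (m : ℕ) : Type := LaurentPolynomial (Mat m)

/-- `∑ i, B i * z ^ i` as a Laurent polynomial. -/
def Takiff.toLaurent (g : Takiff m r) : MatLaurent m :=
  ∑ i : Fin (r + 1), AddMonoidAlgebra.single ((i : ℕ) : ℤ) (g.coeff i)

/-- `∑ i, A i * z ^ (-i-1)` as a Laurent polynomial. -/
def TakiffDual.toLaurent (A : TakiffDual m r) : MatLaurent m :=
  ∑ i : Fin (r + 1), AddMonoidAlgebra.single (-((i : ℕ) : ℤ) - 1) (A.coeff i)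

/-- Reduction mod `z ^ (r+1)` of a polynomial in `z`. -/
def modZ (r : ℕ) (f : MatLaurent m) : Takiff m r := fun i => f.coeff ((i : ℕ) : ℤ)

/-- The projection `π₋` to the polar part. It is only applied to Laurent polynomials whose pole has
order at most `r + 1`. -/
def piMinus (r : ℕ) (f : MatLaurent m) : TakiffDual m r := fun i => f.coeff (-((i : ℕ) : ℤ) - 1)

/-- Multiplication mod `z ^ (r+1)`. -/
instance : Mul (Takiff m r) := ⟨fun g h => modZ r (g.toLaurent * h.toLaurent)⟩

instance : One (Takiff m r) := ⟨modZ r 1⟩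

theorem Takiff.coeff_mul (g h : Takiff m r) (k : Fin (r + 1)) :
    (g * h).coeff k = ∑ i : Fin (r + 1), ∑ j : Fin (r + 1),
      if (i : ℕ) + (j : ℕ) = (k : ℕ) then g.coeff i * h.coeff j else 0 := by
  change (g.toLaurent * h.toLaurent).coeff ((k : ℕ) : ℤ) = _
  simp only [Takiff.toLaurent, Finset.sum_mul_sum, AddMonoidAlgebra.single_mul_single,
    AddMonoidAlgebra.coeff_sum, Finsupp.finsetSum_apply, AddMonoidAlgebra.coeff_single,
    Finsupp.single_apply]
  refine Finset.sum_congr rfl fun i _ => Finset.sum_congr rfl fun j _ => ?_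
  norm_cast

theorem Takiff.coeff_one (k : Fin (r + 1)) :
    (1 : Takiff m r).coeff k = if (k : ℕ) = 0 then 1 else 0 := by
  change (1 : MatLaurent m).coeff ((k : ℕ) : ℤ) = _
  rw [AddMonoidAlgebra.one_def, AddMonoidAlgebra.coeff_single, Finsupp.single_apply]
  norm_cast
  simp [eq_comm]

theorem sum_convolution_aux (X : Mat m) (s l : ℕ) (n : Fin (r + 1)) :
    (∑ a : Fin (r + 1), if (a : ℕ) + l = n then (if s = (a : ℕ) then X else 0) else 0) =
      if s + l = n then X else 0 := by
  by_cases h : s + l = n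
  · rw [if_pos h, Finset.sum_eq_single (⟨s, by omega⟩ : Fin (r + 1))]
    · rw [if_pos h, if_pos rfl]
    · intro b _ hb
      have : s ≠ (b : ℕ) := by rintro rfl; exact hb rfl
      simp [this]
    · exact fun h => absurd (Finset.mem_univ _) h
  · rw [if_neg h]
    refine Finset.sum_eq_zero fun a _ => ?_
    split_ifs with h1 h2
    · omega
    all_goals rfl

theorem Takiff.coeff_mul_mul (f g h : Takiff m r) (n : Fin (r + 1)) :
    (f * g * h).coeff n = ∑ l : Fin (r + 1), ∑ i : Fin (r + 1), ∑ j : Fin (r + 1),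
      if (i : ℕ) + j + l = n then f.coeff i * g.coeff j * h.coeff l else 0 := by
  rw [Takiff.coeff_mul, Finset.sum_comm]
  refine Finset.sum_congr rfl fun l _ => ?_
  have h1 : ∀ i j : Fin (r + 1),
      (if (i : ℕ) + j + l = n then f.coeff i * g.coeff j * h.coeff l else 0) =
        ∑ a : Fin (r + 1), if (a : ℕ) + l = n then
          (if (i : ℕ) + j = a then f.coeff i * g.coeff j * h.coeff l else 0) else 0 :=
    fun i j => (sum_convolution_aux _ _ _ _).symm
  simp only [h1]
  rw [Finset.sum_congr rfl fun i _ => Finset.sum_comm, Finset.sum_comm]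
  refine Finset.sum_congr rfl fun a _ => ?_
  split_ifs
  · rw [Takiff.coeff_mul, Finset.sum_mul]
    refine Finset.sum_congr rfl fun i _ => ?_
    rw [Finset.sum_mul]
    exact Finset.sum_congr rfl fun j _ => by split_ifs <;> simp
  · simp

theorem Takiff.mul_assoc_aux (f g h : Takiff m r) : f * g * h = f * (g * h) := by
  ext1 n
  have e2 : (f * (g * h)).coeff n = ∑ i : Fin (r + 1), ∑ j : Fin (r + 1), ∑ l : Fin (r + 1),
      if (i : ℕ) + j + l = n then f.coeff i * g.coeff j * h.coeff l else 0 := by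
    rw [Takiff.coeff_mul]
    refine Finset.sum_congr rfl fun i _ => ?_
    have h1 : ∀ j l : Fin (r + 1),
        (if (i : ℕ) + j + l = n then f.coeff i * g.coeff j * h.coeff l else 0) =
          ∑ a : Fin (r + 1), if (a : ℕ) + i = n then
            (if (j : ℕ) + l = a then f.coeff i * g.coeff j * h.coeff l else 0) else 0 := by
      intro j l
      rw [sum_convolution_aux]
      congr 1
      exact propext ⟨fun _ => by omega, fun _ => by omega⟩
    simp only [h1]
    rw [Finset.sum_congr rfl fun j _ => Finset.sum_comm, Finset.sum_comm]
    refine Finset.sum_congr rfl fun a _ => ?_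
    rw [add_comm (i : ℕ)]
    split_ifs
    · rw [Takiff.coeff_mul, Finset.mul_sum]
      refine Finset.sum_congr rfl fun i _ => ?_
      rw [Finset.mul_sum]
      exact Finset.sum_congr rfl fun j _ => by split_ifs <;> simp [mul_assoc]
    · simp
  rw [Takiff.coeff_mul_mul, e2, Finset.sum_comm]
  exact Finset.sum_congr rfl fun i _ => Finset.sum_comm

theorem Takiff.one_mul_aux (g : Takiff m r) : 1 * g = g := by
  ext1 k
  rw [Takiff.coeff_mul, Finset.sum_eq_single (0 : Fin (r + 1)), Finset.sum_eq_single k]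
  · simp [Takiff.coeff_one]
  · intro b _ hb
    rw [if_neg]
    simpa [Fin.ext_iff] using hb
  · exact fun h => absurd (Finset.mem_univ _) h
  · intro b _ hb
    have : (b : ℕ) ≠ 0 := fun h => hb (Fin.ext h)
    simp [Takiff.coeff_one, this]
  · exact fun h => absurd (Finset.mem_univ _) h

theorem Takiff.mul_one_aux (g : Takiff m r) : g * 1 = g := by
  ext1 k
  rw [Takiff.coeff_mul, Finset.sum_comm, Finset.sum_eq_single (0 : Fin (r + 1)),
    Finset.sum_eq_single k]
  · simp [Takiff.coeff_one]
  · intro b _ hb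
    rw [if_neg]
    simpa [Fin.ext_iff] using hb
  · exact fun h => absurd (Finset.mem_univ _) h
  · intro b _ hb
    have : (b : ℕ) ≠ 0 := fun h => hb (Fin.ext h)
    simp [Takiff.coeff_one, this]
  · exact fun h => absurd (Finset.mem_univ _) h

/-- The associative algebra `𝔤𝔩_m[z] / z ^ (r+1)`. Its commutator is the Takiff bracket. -/
instance : Ring (Takiff m r) :=
  { (inferInstance : AddCommGroup (Takiff m r)) with
    mul := (· * ·)
    one := 1
    mul_assoc := Takiff.mul_assoc_aux
    one_mul := Takiff.one_mul_aux
    mul_one := Takiff.mul_one_aux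
    zero_mul := fun a => by ext1 k; simp [Takiff.coeff_mul]
    mul_zero := fun a => by ext1 k; simp [Takiff.coeff_mul]
    left_distrib := fun a b c => by
      ext1 k
      simp only [Takiff.coeff_mul, Takiff.coeff_add, ← Finset.sum_add_distrib, mul_add]
      exact Finset.sum_congr rfl fun i _ => Finset.sum_congr rfl fun j _ => by split_ifs <;> simp
    right_distrib := fun a b c => by
      ext1 k
      simp only [Takiff.coeff_mul, Takiff.coeff_add, ← Finset.sum_add_distrib, add_mul]
      exact Finset.sum_congr rfl fun i _ => Finset.sum_congr rfl fun j _ => by split_ifs <;> simp }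

theorem Takiff.coeff_zero_mul (g h : Takiff m r) :
    (g * h).coeff 0 = g.coeff 0 * h.coeff 0 := by
  rw [Takiff.coeff_mul, Finset.sum_eq_single (0 : Fin (r + 1)),
    Finset.sum_eq_single (0 : Fin (r + 1))]
  · simp
  · intro b _ hb
    exact if_neg fun h => hb (Fin.ext (by simpa using h))
  · exact fun h => absurd (Finset.mem_univ _) h
  · intro b _ hb
    refine Finset.sum_eq_zero fun j _ => if_neg fun h => hb (Fin.ext ?_)
    simp at h ⊢
    omega
  · exact fun h => absurd (Finset.mem_univ _) h

theorem Takiff.coeff_pow_eq_zero (n : Takiff m r) (h0 : n.coeff 0 = 0) (k : ℕ) :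
    ∀ i : Fin (r + 1), (i : ℕ) < k → (n ^ k).coeff i = 0 := by
  induction k with
  | zero => intro i hi; omega
  | succ k ih =>
    intro i hi
    rw [pow_succ, Takiff.coeff_mul]
    refine Finset.sum_eq_zero fun a _ => Finset.sum_eq_zero fun b _ => ?_
    split_ifs with h
    · by_cases hb : b = 0
      · rw [hb, h0, mul_zero]
      · have : (b : ℕ) ≠ 0 := fun h => hb (Fin.ext h)
        rw [ih a (by omega), zero_mul]
    · rfl

theorem Takiff.isUnit_iff (g : Takiff m r) : IsUnit g ↔ IsUnit (g.coeff 0) := by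
  have h1 : (1 : Takiff m r).coeff 0 = 1 := by simp [Takiff.coeff_one]
  constructor
  · rintro ⟨u, rfl⟩
    refine ⟨⟨_, (u⁻¹).1.coeff 0,
      (Takiff.coeff_zero_mul u.1 (u⁻¹).1).symm.trans (by rw [Units.mul_inv, h1]),
      (Takiff.coeff_zero_mul (u⁻¹).1 u.1).symm.trans (by rw [Units.inv_mul, h1])⟩, rfl⟩
  · rintro ⟨u, hu⟩
    let c : Mat m → Takiff m r := fun B i => if (i : ℕ) = 0 then B else 0
    have hc : ∀ B, (c B).coeff 0 = B := fun B => by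
      change (if ((0 : Fin (r + 1)) : ℕ) = 0 then B else 0) = B
      exact if_pos rfl
    have key : ∀ a : Takiff m r, a.coeff 0 = 1 → IsUnit a := by
      intro a ha
      have hn : IsNilpotent (a - 1) := by
        refine ⟨r + 1, ?_⟩
        ext1 i
        refine Takiff.coeff_pow_eq_zero _ ?_ _ i i.isLt
        change a.coeff 0 - (1 : Takiff m r).coeff 0 = 0
        rw [ha, h1, sub_self]
      simpa using hn.isUnit_one_add
    obtain ⟨v, hv⟩ := key (g * c (u⁻¹).1) (by rw [Takiff.coeff_zero_mul, hc, ← hu]; simp)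
    obtain ⟨w, hw⟩ := key (c (u⁻¹).1 * g) (by rw [Takiff.coeff_zero_mul, hc, ← hu]; simp)
    refine isUnit_iff_exists.2 ?_
    have hl : (w⁻¹).1 * c (u⁻¹).1 * g = 1 := by rw [mul_assoc, ← hw]; simp
    have hr : g * (c (u⁻¹).1 * (v⁻¹).1) = 1 := by rw [← mul_assoc, ← hv]; simp
    exact ⟨_, hr, by rw [← left_inv_eq_right_inv hl hr]; exact hl⟩

/-- The group of the Takiff algebra: the units of `𝔤𝔩_m[z] / z ^ (r+1)`, which are the
`g 0 + g 1 * z + ⋯ + g r * z ^ r` with `g 0` invertible. -/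
abbrev TakiffGroup (m r : ℕ) : Type := (Takiff m r)ˣ

/-! ### Pairing and coadjoint action -/

/-- The pairing of the Takiff algebra with its dual, `Res_{z = 0} Tr (A(z) B(z)) dz`. -/
def pairing (A : TakiffDual m r) (B : Takiff m r) : ℂ :=
  ∑ i : Fin (r + 1), (A.coeff i * B.coeff i).trace

/-- Multiplication by `z ^ (r+1)`, as a map from the dual to the Takiff algebra. -/
def TakiffDual.shift (A : TakiffDual m r) : Takiff m r := fun i => A i.rev

theorem TakiffDual.shift_injective :
    Function.Injective (TakiffDual.shift : TakiffDual m r → Takiff m r) := by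
  intro A B h
  ext1 i
  have h' : A i.rev.rev = B i.rev.rev := congrFun h i.rev
  rwa [Fin.rev_rev] at h'

theorem shift_piMinus_mul_mul (g : Takiff m r) (A : TakiffDual m r) (h : Takiff m r) :
    (piMinus r (g.toLaurent * A.toLaurent * h.toLaurent)).shift = g * A.shift * h := by
  ext1 n
  rw [Takiff.coeff_mul_mul]
  change (g.toLaurent * A.toLaurent * h.toLaurent).coeff (-((n.rev : ℕ) : ℤ) - 1) = _
  simp only [Takiff.toLaurent, TakiffDual.toLaurent, Finset.sum_mul, Finset.mul_sum, AddMonoidAlgebra.single_mul_single,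
    AddMonoidAlgebra.coeff_sum, Finsupp.finsetSum_apply, AddMonoidAlgebra.coeff_single,
    Finsupp.single_apply]
  refine Finset.sum_congr rfl fun l _ => ?_
  rw [Finset.sum_comm]
  refine Finset.sum_congr rfl fun i _ => ?_
  rw [← Equiv.sum_comp Fin.revPerm]
  refine Finset.sum_congr rfl fun j _ => ?_
  simp only [Fin.revPerm_apply, Fin.val_rev]
  have hj := j.isLt
  have hn := n.isLt
  have e : ((i : ℕ) : ℤ) + (-((r + 1 - (j + 1) : ℕ) : ℤ) - 1) + ((l : ℕ) : ℤ) =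
      -((r + 1 - (n + 1) : ℕ) : ℤ) - 1 ↔ (i : ℕ) + j + l = n := by omega
  rw [if_congr e rfl rfl]
  rfl

theorem Takiff.toLaurent_one : (1 : Takiff m r).toLaurent = 1 := by
  rw [Takiff.toLaurent, Finset.sum_eq_single (0 : Fin (r + 1))]
  · rw [Takiff.coeff_one, if_pos (by rfl), AddMonoidAlgebra.one_def]
    rfl
  · intro b _ hb
    have : (b : ℕ) ≠ 0 := fun h => hb (Fin.ext h)
    simp [Takiff.coeff_one, this]
  · exact fun h => absurd (Finset.mem_univ _) h

theorem shift_piMinus_mul (g : Takiff m r) (A : TakiffDual m r) :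
    (piMinus r (g.toLaurent * A.toLaurent)).shift = g * A.shift := by
  simpa [Takiff.toLaurent_one] using shift_piMinus_mul_mul g A 1

/-- The coadjoint action `Ad*_g A = π₋[g A g⁻¹]`. -/
instance : MulAction (TakiffGroup m r) (TakiffDual m r) where
  smul g A := piMinus r
    ((g : Takiff m r).toLaurent * A.toLaurent * ((g⁻¹ : TakiffGroup m r) : Takiff m r).toLaurent)
  one_smul A := by
    apply TakiffDual.shift_injective
    refine (shift_piMinus_mul_mul _ _ _).trans ?_
    simp
  mul_smul g h A := by
    apply TakiffDual.shift_injective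
    refine (shift_piMinus_mul_mul _ _ _).trans ?_
    refine Eq.trans ?_ (shift_piMinus_mul_mul _ _ _).symm
    change _ = _ * (piMinus r _).shift * _
    rw [shift_piMinus_mul_mul]
    simp [mul_assoc]

theorem Takiff.toLaurent_add (g h : Takiff m r) :
    (g + h).toLaurent = g.toLaurent + h.toLaurent := by
  simp [Takiff.toLaurent, Finset.sum_add_distrib]

theorem Takiff.toLaurent_smul (c : ℂ) (g : Takiff m r) :
    (c • g).toLaurent = c • g.toLaurent := by
  simp only [Takiff.toLaurent, Finset.smul_sum, Takiff.coeff_smul, AddMonoidAlgebra.smul_single]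

theorem piMinus_add (f g : MatLaurent m) : piMinus r (f + g) = piMinus r f + piMinus r g := rfl

theorem piMinus_smul (c : ℂ) (f : MatLaurent m) : piMinus r (c • f) = c • piMinus r f := rfl

/-- The infinitesimal coadjoint action `ξ ↦ ad*_ξ A = π₋[ξ A - A ξ]`. -/
def coad (A : TakiffDual m r) : Takiff m r →ₗ[ℂ] TakiffDual m r where
  toFun ξ := piMinus r (ξ.toLaurent * A.toLaurent - A.toLaurent * ξ.toLaurent)
  map_add' ξ η := by
    rw [← piMinus_add, Takiff.toLaurent_add]
    congr 1
    noncomm_ring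
  map_smul' c ξ := by
    rw [RingHom.id_apply, ← piMinus_smul, Takiff.toLaurent_smul, smul_sub, smul_mul_assoc,
      mul_smul_comm]

/-- The tangent space at `A` of the coadjoint orbit through `A`. -/
def orbitTangent (A : TakiffDual m r) : Submodule ℂ (TakiffDual m r) := LinearMap.range (coad A)

/-- `K` is the Kirillov-Kostant-Souriau form at the point `A` of its coadjoint orbit:
`K (ad*_ξ A, ad*_η A) = - ⟨A, [ξ, η]⟩`. -/
def IsKKSForm (A : TakiffDual m r) (K : LinearMap.BilinForm ℂ (orbitTangent A)) : Prop :=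
  ∀ ξ η : Takiff m r,
    K ⟨coad A ξ, ξ, rfl⟩ ⟨coad A η, η, rfl⟩ = -pairing A (ξ * η - η * ξ)

/-! ### The extended phase space, the inner action and the two moment maps -/

/-- The cotangent bundle of the Takiff algebra: pairs `(Q, P)` with `Q = ∑ i, Q i * z ^ i` and
`P = ∑ i, P i * z ^ (-i-1)`. -/
def PhaseSpace (m r : ℕ) : Type := Takiff m r × TakiffDual m r

instance : AddCommGroup (PhaseSpace m r) :=
  inferInstanceAs (AddCommGroup (Takiff m r × TakiffDual m r))
instance : Module ℂ (PhaseSpace m r) := inferInstanceAs (Module ℂ (Takiff m r × TakiffDual m r))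
instance : TopologicalSpace (PhaseSpace m r) :=
  inferInstanceAs (TopologicalSpace (Takiff m r × TakiffDual m r))

def PhaseSpace.Q (x : PhaseSpace m r) : Takiff m r := x.1

def PhaseSpace.P (x : PhaseSpace m r) : TakiffDual m r := x.2

@[ext] theorem PhaseSpace.ext {x y : PhaseSpace m r} (hQ : x.Q = y.Q) (hP : x.P = y.P) : x = y :=
  Prod.ext hQ hP

/-- The symplectic form `d⟨P, dQ⟩ = ∑ i, Tr (dP i ∧ dQ i)`; it has constant coefficients. -/
def omega (u v : PhaseSpace m r) : ℂ := pairing u.P v.Q - pairing v.P u.Q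

/-- The inner action `g • (Q, P) = (Q g⁻¹ mod z ^ (r+1), π₋[g P])`. -/
instance : MulAction (TakiffGroup m r) (PhaseSpace m r) where
  smul g x := (x.Q * ((g⁻¹ : TakiffGroup m r) : Takiff m r),
    piMinus r ((g : Takiff m r).toLaurent * x.P.toLaurent))
  one_smul x := by
    refine PhaseSpace.ext ?_ ?_
    · exact (mul_one x.Q)
    · apply TakiffDual.shift_injective
      refine (shift_piMinus_mul _ _).trans ?_
      simp
  mul_smul g h x := by
    refine PhaseSpace.ext ?_ ?_
    · change x.Q * _ = x.Q * _ * _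
      simp [mul_assoc]
    · apply TakiffDual.shift_injective
      refine (shift_piMinus_mul _ _).trans ?_
      refine Eq.trans ?_ (shift_piMinus_mul _ _).symm
      change _ = _ * (piMinus r _).shift
      rw [shift_piMinus_mul]
      simp [mul_assoc]

/-- The infinitesimal inner action `ξ ↦ (-Q ξ mod z ^ (r+1), π₋[ξ P])` at the point `(Q, P)`. -/
def innerInf (x : PhaseSpace m r) : Takiff m r →ₗ[ℂ] PhaseSpace m r where
  toFun ξ := (-(x.Q * ξ), piMinus r (ξ.toLaurent * x.P.toLaurent))
  map_add' ξ η := by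
    refine PhaseSpace.ext ?_ ?_
    · change -(x.Q * (ξ + η)) = -(x.Q * ξ) + -(x.Q * η)
      noncomm_ring
    · change piMinus r _ = piMinus r _ + piMinus r _
      rw [← piMinus_add, Takiff.toLaurent_add, add_mul]
  map_smul' c ξ := by
    refine PhaseSpace.ext ?_ ?_
    · change -(x.Q * (c • ξ)) = c • -(x.Q * ξ)
      rw [smul_neg]
      congr 1
      ext1 k
      simp [Takiff.coeff_mul, Finset.smul_sum]
    · change piMinus r _ = c • piMinus r _
      rw [← piMinus_smul, Takiff.toLaurent_smul, smul_mul_assoc]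

/-- The moment map of the inner action, `Λ(z) = π₋[P Q]`. -/
def momentInner (x : PhaseSpace m r) : TakiffDual m r := piMinus r (x.P.toLaurent * x.Q.toLaurent)

/-- `A(z) = π₋[Q P]`. -/
def matA (x : PhaseSpace m r) : TakiffDual m r := piMinus r (x.Q.toLaurent * x.P.toLaurent)

theorem matA_smul (g : TakiffGroup m r) (x : PhaseSpace m r) : matA (g • x) = matA x := by
  apply TakiffDual.shift_injective
  refine (shift_piMinus_mul _ _).trans ?_
  refine Eq.trans ?_ (shift_piMinus_mul _ _).symm
  change x.Q * _ * (piMinus r _).shift = _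
  rw [shift_piMinus_mul]
  simp [mul_assoc]

/-! ### Spaces with functions -/

/-- The data of a classical algebraic variety, as a space with functions: its Zariski open subsets,
and, for `U` open, the functions which are regular on `U` (only their values on `U` matter). -/
structure SpaceWithFunctions (X : Type) where
  IsOpen : Set X → Prop
  IsRegularOn : Set X → (X → ℂ) → Prop

/-- The polynomial functions on a complex vector space. -/
def polyFun (V : Type) [AddCommGroup V] [Module ℂ V] : Subalgebra ℂ (V → ℂ) :=
  Algebra.adjoin ℂ {f | ∃ l : Module.Dual ℂ V, f = fun v => l v}

/-- A complex vector space with its Zariski topology and its regular functions, which are locally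
quotients of polynomials. -/
def affineSpace (V : Type) [AddCommGroup V] [Module ℂ V] : SpaceWithFunctions V where
  IsOpen U := ∀ x ∈ U, ∃ b ∈ polyFun V, b x ≠ 0 ∧ ∀ y, b y ≠ 0 → y ∈ U
  IsRegularOn U f := ∀ x ∈ U, ∃ a ∈ polyFun V, ∃ b ∈ polyFun V, b x ≠ 0 ∧
    ∀ y ∈ U, b y ≠ 0 → f y = a y / b y

/-- The induced structure on a subset: the subspace topology, and the functions that extend
locally to regular functions of the ambient space. -/
def SpaceWithFunctions.sub {X : Type} (𝒳 : SpaceWithFunctions X) (S : Set X) :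
    SpaceWithFunctions S where
  IsOpen U := ∃ W, 𝒳.IsOpen W ∧ U = Subtype.val ⁻¹' W
  IsRegularOn U f := ∀ x ∈ U, ∃ W, 𝒳.IsOpen W ∧ x.1 ∈ W ∧ ∃ h, 𝒳.IsRegularOn W h ∧
    ∀ y ∈ U, y.1 ∈ W → f y = h y.1

/-- The quotient structure: the quotient topology, and the functions whose pull-back is regular. -/
def SpaceWithFunctions.quotient {X : Type} (𝒳 : SpaceWithFunctions X) (s : Setoid X) :
    SpaceWithFunctions (Quotient s) where
  IsOpen U := 𝒳.IsOpen (Quotient.mk s ⁻¹' U)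
  IsRegularOn U f := 𝒳.IsRegularOn (Quotient.mk s ⁻¹' U) (f ∘ Quotient.mk s)

/-- Isomorphisms (biregular maps) of spaces with functions. -/
structure IsBiregular {X Y : Type} (𝒳 : SpaceWithFunctions X) (𝒴 : SpaceWithFunctions Y)
    (φ : X → Y) : Prop where
  bijective : Function.Bijective φ
  isOpen_iff : ∀ U : Set Y, 𝒴.IsOpen U ↔ 𝒳.IsOpen (φ ⁻¹' U)
  isRegularOn_iff : ∀ U : Set Y, 𝒴.IsOpen U → ∀ f : Y → ℂ,
    𝒴.IsRegularOn U f ↔ 𝒳.IsRegularOn (φ ⁻¹' U) (f ∘ φ)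

/-! ### The Hamiltonian reduction -/

/-- The level set of the inner moment map. -/
abbrev levelSet (L : TakiffDual m r) : Set (PhaseSpace m r) := {x | momentInner x = L}

/-- Two points of the level set of `L` are identified when they differ by the inner action of an
element of the stabilizer of `L` in the Takiff group. -/
def reductionSetoid (L : TakiffDual m r) : Setoid (levelSet L) :=
  (MulAction.orbitRel (MulAction.stabilizer (TakiffGroup m r) L) (PhaseSpace m r)).comap
    Subtype.val

/-- The Hamiltonian reduction of the phase space with respect to the inner action, at the
value `L` of the moment map. -/
abbrev Reduction (L : TakiffDual m r) : Type := Quotient (reductionSetoid L)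

/-- The Hamiltonian reduction as a geometric quotient. -/
def reductionSpace (L : TakiffDual m r) : SpaceWithFunctions (Reduction L) :=
  ((affineSpace (PhaseSpace m r)).sub (levelSet L)).quotient (reductionSetoid L)

/-- The coadjoint orbit of `L`, as a subvariety of the dual of the Takiff algebra. -/
def orbitSpace (L : TakiffDual m r) :
    SpaceWithFunctions (MulAction.orbit (TakiffGroup m r) L) :=
  (affineSpace (TakiffDual m r)).sub (MulAction.orbit (TakiffGroup m r) L)

/-- The map induced by `(Q, P) ↦ A(z) = π₋[Q P]` on the Hamiltonian reduction. -/
def reducedMap (L : TakiffDual m r) : Reduction L → TakiffDual m r :=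
  Quotient.lift (fun x => matA x.1) (by
    rintro x y ⟨g, hg⟩
    have hg' : (g : TakiffGroup m r) • y.1 = x.1 := hg
    rw [← hg', matA_smul])

/-- The differential of the inner moment map. -/
def dMoment (x : PhaseSpace m r) : PhaseSpace m r →ₗ[ℂ] TakiffDual m r :=
  (fderiv ℂ (momentInner (m := m) (r := r)) x).toLinearMap

/-- The differential of `(Q, P) ↦ A(z)`. -/
def dA (x : PhaseSpace m r) : PhaseSpace m r →ₗ[ℂ] TakiffDual m r :=
  (fderiv ℂ (matA (m := m) (r := r)) x).toLinearMap

/-- The tangent space at `x` of the level set through `x` of the inner moment map. -/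
abbrev levelTangent (x : PhaseSpace m r) : Submodule ℂ (PhaseSpace m r) :=
  LinearMap.ker (dMoment x)

/-- The tangent directions at `x` along the inner action of the stabilizer of `Λ(x)`, whose Lie
algebra is the kernel of `ξ ↦ ad*_ξ Λ(x)`. -/
def stabTangent (x : PhaseSpace m r) : Submodule ℂ (PhaseSpace m r) :=
  (LinearMap.ker (coad (momentInner x))).map (innerInf x)

/-- The tangent space of the Hamiltonian reduction at the class of `x`. -/
abbrev reducedTangent (x : PhaseSpace m r) : Type :=
  levelTangent x ⧸ (stabTangent x).comap (levelTangent x).subtype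

/-- `Ω` is the reduced symplectic form at the class of `x`: its pull-back to the level set is the
restriction of `omega`. -/
def IsReducedForm (x : PhaseSpace m r) (Ω : LinearMap.BilinForm ℂ (reducedTangent x)) : Prop :=
  ∀ u v : levelTangent x,
    Ω (Submodule.Quotient.mk u) (Submodule.Quotient.mk v) = omega u.1 v.1

/-- The inner action is a Hamiltonian action by symplectic maps, with equivariant moment map
`momentInner`. -/
structure InnerActionIsHamiltonian (m r : ℕ) : Prop where
  symplectic : ∀ (g : TakiffGroup m r) (u v : PhaseSpace m r), omega (g • u) (g • v) = omega u v
  moment : ∀ (ξ : Takiff m r) (x v : PhaseSpace m r),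
    omega (innerInf x ξ) v = pairing (dMoment x v) ξ
  equivariant : ∀ (g : TakiffGroup m r) (x : PhaseSpace m r),
    momentInner (g • x) = g • momentInner x

/-- The reduced map restricts to a symplectomorphism from the nonempty Zariski open subset `D` of
the Hamiltonian reduction at `L` onto the whole coadjoint orbit of `L`: an isomorphism of algebraic
varieties whose differential takes the reduced symplectic form to the
Kirillov-Kostant-Souriau form. -/
structure IsSymplectomorphismOn (L : TakiffDual m r) (D : Set (Reduction L)) : Prop where
  isOpen : (reductionSpace L).IsOpen D
  nonempty : D.Nonempty
  mapsTo : Set.MapsTo (reducedMap L) D (MulAction.orbit (TakiffGroup m r) L)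
  isBiregular : IsBiregular ((reductionSpace L).sub D) (orbitSpace L)
    (Set.MapsTo.restrict (reducedMap L) D (MulAction.orbit (TakiffGroup m r) L) mapsTo)
  /-- `L` is a regular value on the part of the level set over `D`. -/
  surjective : ∀ x : levelSet L, Quotient.mk (reductionSetoid L) x ∈ D →
    Function.Surjective (dMoment x.1)
  symplectic : ∀ x : levelSet L, Quotient.mk (reductionSetoid L) x ∈ D →
    ∃ (Ω : LinearMap.BilinForm ℂ (reducedTangent x.1))
      (K : LinearMap.BilinForm ℂ (orbitTangent (matA x.1)))
      (Φ : reducedTangent x.1 ≃ₗ[ℂ] orbitTangent (matA x.1)),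
      IsReducedForm x.1 Ω ∧ Ω.Nondegenerate ∧ IsKKSForm (matA x.1) K ∧ K.Nondegenerate ∧
      (∀ u : levelTangent x.1, (Φ (Submodule.Quotient.mk u) : TakiffDual m r) = dA x.1 u.1) ∧
      ∀ a b : reducedTangent x.1, K (Φ a) (Φ b) = Ω a b

/-- The part of the reduction where `Q(z)` is invertible, that is, `Q 0` is. -/
def domainQ (L : TakiffDual m r) : Set (Reduction L) :=
  Quotient.mk (reductionSetoid L) '' {x | IsUnit (x.1.Q.coeff 0)}

/-- The part of the reduction where `z ^ (r+1) P(z)` is invertible, that is, `P r` is. -/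
def domainP (L : TakiffDual m r) : Set (Reduction L) :=
  Quotient.mk (reductionSetoid L) '' {x | IsUnit (x.1.P.coeff (Fin.last r))}

end TakiffReduction

end

open TakiffReduction

/-!
Multiplication by `z ^ (r+1)` identifies `ĝ_r*` with the associative algebra `R = ĝ_r`, hence the
phase space with `R × R`. There `Λ = P Q` and `A = Q P`, and coadjoint orbits become conjugacy
classes.

Besides the inner action there is the outer one, `g • (Q, P) = (g Q, P g⁻¹)`. Its moment map
is `-A`, it fixes `Λ`, and the inner action fixes `A`. At a point where `Q` or `P` is invertible,
`ker dΛ` consists of the outer directions and `ker dA` of the inner ones. So `dA` identifies the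
reduced tangent space with the tangent space of the orbit, and `ω (v, outer ξ) = ⟨dA v, ξ⟩` turns
the reduced form into the Kirillov-Kostant-Souriau form.

An invertible `Q` conjugates `Λ` to `A`, and so does the inverse of an invertible `P`; this gives
bijectivity onto the orbit of `L`. The inverse map is regular because `g ↦ g L g⁻¹` has local
regular sections over the orbit: the equation `q L = y q` is linear in `q`, and its solution space
has constant dimension as `y` runs over the orbit, so that the solution `q = g` at `y = g L g⁻¹`
extends to a regular family.
-/

namespace TakiffReduction

open Filter

/-! ### Morphisms of spaces with functions -/

section SpaceWithFunctions

variable {X Y Z : Type} {𝒳 : SpaceWithFunctions X} {𝒴 : SpaceWithFunctions Y}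
  {𝒵 : SpaceWithFunctions Z}

/-- Openness of a set and regularity of a function on an open set are local properties, as they are
for every variety; `SpaceWithFunctions` itself imposes no axioms. -/
structure SpaceWithFunctions.IsSheaf (𝒳 : SpaceWithFunctions X) : Prop where
  isOpen_inter {U U' : Set X} : 𝒳.IsOpen U → 𝒳.IsOpen U' → 𝒳.IsOpen (U ∩ U')
  isOpen_of_local {U : Set X} : (∀ x ∈ U, ∃ N ⊆ U, x ∈ N ∧ 𝒳.IsOpen N) → 𝒳.IsOpen U
  isRegularOn_of_local {U : Set X} {f : X → ℂ} : 𝒳.IsOpen U →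
    (∀ x ∈ U, ∃ N, x ∈ N ∧ 𝒳.IsOpen N ∧ ∃ h, 𝒳.IsRegularOn N h ∧ ∀ y ∈ U ∩ N, f y = h y) →
    𝒳.IsRegularOn U f

namespace SpaceWithFunctions.IsSheaf

theorem isRegularOn_mono (h𝒳 : 𝒳.IsSheaf) {U U' : Set X} {f : X → ℂ} (hU : 𝒳.IsOpen U)
    (hU' : 𝒳.IsOpen U') (hle : U' ⊆ U) (hf : 𝒳.IsRegularOn U f) : 𝒳.IsRegularOn U' f :=
  h𝒳.isRegularOn_of_local hU' fun _ hx => ⟨U, hle hx, hU, f, hf, fun _ _ => rfl⟩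

theorem sub (h𝒳 : 𝒳.IsSheaf) (S : Set X) : (𝒳.sub S).IsSheaf where
  isOpen_inter := by
    rintro _ _ ⟨W, hW, rfl⟩ ⟨W', hW', rfl⟩
    exact ⟨W ∩ W', h𝒳.isOpen_inter hW hW', rfl⟩
  isOpen_of_local {U} hU := by
    refine ⟨⋃₀ {W | 𝒳.IsOpen W ∧ Subtype.val ⁻¹' W ⊆ U},
      h𝒳.isOpen_of_local fun x ⟨W, hW, hx⟩ => ⟨W, fun _ hz => ⟨W, hW, hz⟩, hx, hW.1⟩, ?_⟩
    ext x
    refine ⟨fun hx => ?_, fun ⟨W, hW, hx⟩ => hW.2 hx⟩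
    obtain ⟨_, hWU, hxW, W, hW, rfl⟩ := hU x hx
    exact ⟨W, ⟨hW, hWU⟩, hxW⟩
  isRegularOn_of_local _ hf := fun x hx => by
    obtain ⟨_, hxW, ⟨W, hW, rfl⟩, h, hh, hfh⟩ := hf x hx
    obtain ⟨W', hW', hxW', h', hh', hhh'⟩ := hh x hxW
    exact ⟨W ∩ W', h𝒳.isOpen_inter hW hW', ⟨hxW, hxW'⟩, h',
      h𝒳.isRegularOn_mono hW' (h𝒳.isOpen_inter hW hW') Set.inter_subset_right hh',
      fun y hyU hy => (hfh y ⟨hyU, hy.1⟩).trans (hhh' y hy.1 hy.2)⟩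

theorem quotient (h𝒳 : 𝒳.IsSheaf) (s : Setoid X) : (𝒳.quotient s).IsSheaf where
  isOpen_inter hU hU' := h𝒳.isOpen_inter hU hU'
  isOpen_of_local hU := h𝒳.isOpen_of_local fun _ hx =>
    let ⟨_, hNU, hxN, hN⟩ := hU _ hx
    ⟨_, Set.preimage_mono hNU, hxN, hN⟩
  isRegularOn_of_local hU hf := h𝒳.isRegularOn_of_local hU fun _ hx =>
    let ⟨_, hxN, hN, _, hh, hfh⟩ := hf _ hx
    ⟨_, hxN, hN, _, hh, fun _ hy => hfh _ hy⟩

end SpaceWithFunctions.IsSheaf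

/-- Morphisms of spaces with functions: continuous maps that pull regular functions back to regular
functions. -/
structure IsMorphism (𝒳 : SpaceWithFunctions X) (𝒴 : SpaceWithFunctions Y) (φ : X → Y) :
    Prop where
  isOpen_preimage {U : Set Y} : 𝒴.IsOpen U → 𝒳.IsOpen (φ ⁻¹' U)
  isRegularOn_comp {U : Set Y} {f : Y → ℂ} : 𝒴.IsOpen U → 𝒴.IsRegularOn U f →
    𝒳.IsRegularOn (φ ⁻¹' U) (f ∘ φ)

namespace IsMorphism

theorem comp {ψ : Y → Z} {φ : X → Y} (hψ : IsMorphism 𝒴 𝒵 ψ) (hφ : IsMorphism 𝒳 𝒴 φ) :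
    IsMorphism 𝒳 𝒵 (ψ ∘ φ) where
  isOpen_preimage hU := hφ.isOpen_preimage (hψ.isOpen_preimage hU)
  isRegularOn_comp hU hf :=
    hφ.isRegularOn_comp (hψ.isOpen_preimage hU) (hψ.isRegularOn_comp hU hf)

theorem val (S : Set X) : IsMorphism (𝒳.sub S) 𝒳 Subtype.val where
  isOpen_preimage hU := ⟨_, hU, rfl⟩
  isRegularOn_comp hU hf := fun _ hx => ⟨_, hU, hx, _, hf, fun _ _ _ => rfl⟩

theorem of_val_comp (h𝒳 : 𝒳.IsSheaf) {S : Set Y} {φ : X → S}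
    (hφ : IsMorphism 𝒳 𝒴 (Subtype.val ∘ φ)) : IsMorphism 𝒳 (𝒴.sub S) φ where
  isOpen_preimage := by
    rintro _ ⟨W, hW, rfl⟩
    exact hφ.isOpen_preimage hW
  isRegularOn_comp := by
    rintro _ f ⟨W, hW, rfl⟩ hf
    refine h𝒳.isRegularOn_of_local (hφ.isOpen_preimage hW) fun x hx => ?_
    obtain ⟨N, hN, hxN, h, hh, hfh⟩ := hf _ hx
    exact ⟨_, hxN, hφ.isOpen_preimage hN, _, hφ.isRegularOn_comp hN hh,
      fun y hy => hfh _ hy.1 hy.2⟩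

theorem quotientMk (s : Setoid X) : IsMorphism 𝒳 (𝒳.quotient s) (Quotient.mk s) where
  isOpen_preimage hU := hU
  isRegularOn_comp _ hf := hf

theorem of_comp_quotientMk {s : Setoid X} {φ : Quotient s → Y}
    (hφ : IsMorphism 𝒳 𝒴 (φ ∘ Quotient.mk s)) : IsMorphism (𝒳.quotient s) 𝒴 φ where
  isOpen_preimage hU := hφ.isOpen_preimage hU
  isRegularOn_comp hU hf := hφ.isRegularOn_comp hU hf

end IsMorphism

theorem IsBiregular.of_local_sections (h𝒴 : 𝒴.IsSheaf) {φ : X → Y} (hφ : IsMorphism 𝒳 𝒴 φ)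
    (hinj : Function.Injective φ)
    (hsec : ∀ y, ∃ N, y ∈ N ∧ 𝒴.IsOpen N ∧ ∃ s : N → X, IsMorphism (𝒴.sub N) 𝒳 s ∧
      ∀ z, φ (s z) = z) : IsBiregular 𝒳 𝒴 φ where
  bijective := ⟨hinj, fun y => let ⟨_, hy, _, s, _, hs⟩ := hsec y; ⟨s ⟨y, hy⟩, hs _⟩⟩
  isOpen_iff U := by
    refine ⟨hφ.isOpen_preimage, fun hU => h𝒴.isOpen_of_local fun y hyU => ?_⟩
    obtain ⟨N, hyN, hN, s, hs, hφs⟩ := hsec y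
    obtain ⟨W, hW, hsW⟩ := hs.isOpen_preimage hU
    have hUW (z : N) : z.1 ∈ U ↔ z.1 ∈ W := by
      simpa only [Set.mem_preimage, hφs] using Set.ext_iff.1 hsW z
    exact ⟨N ∩ W, fun z hz => (hUW ⟨z, hz.1⟩).2 hz.2, ⟨hyN, (hUW ⟨y, hyN⟩).1 hyU⟩,
      h𝒴.isOpen_inter hN hW⟩
  isRegularOn_iff U hU f := by
    refine ⟨hφ.isRegularOn_comp hU, fun hf => h𝒴.isRegularOn_of_local hU fun y hyU => ?_⟩
    obtain ⟨N, hyN, hN, s, hs, hφs⟩ := hsec y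
    obtain ⟨W, hW, hyW, h, hh, hfh⟩ := hs.isRegularOn_comp (hφ.isOpen_preimage hU) hf ⟨y, hyN⟩
      (by simpa only [Set.mem_preimage, hφs] using hyU)
    refine ⟨N ∩ W, ⟨hyN, hyW⟩, h𝒴.isOpen_inter hN hW, h, h𝒴.isRegularOn_mono hW
      (h𝒴.isOpen_inter hN hW) Set.inter_subset_right hh, fun z ⟨hzU, hzN, hzW⟩ => ?_⟩
    simpa only [Function.comp_apply, hφs] using
      hfh ⟨z, hzN⟩ (by simpa only [Set.mem_preimage, hφs] using hzU) hzW

end SpaceWithFunctions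

/-! ### Regular maps between vector spaces -/

section Regular

variable {V : Type} [AddCommGroup V] [Module ℂ V] {W : Type} [AddCommGroup W] [Module ℂ W]
  {E : Type*} [AddCommGroup E] [Module ℂ E] {E' : Type*} [AddCommGroup E'] [Module ℂ E']
  {E'' : Type*} [AddCommGroup E''] [Module ℂ E''] {x : V}

theorem dual_mem_polyFun (l : Module.Dual ℂ V) : (fun v => l v) ∈ polyFun V :=
  Algebra.subset_adjoin ⟨l, rfl⟩

/-- The filter of Zariski neighbourhoods of a point. -/
def zariskiNhds (x : V) : Filter V where
  sets := {U | ∃ b ∈ polyFun V, b x ≠ 0 ∧ ∀ y, b y ≠ 0 → y ∈ U}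
  univ_sets := ⟨1, one_mem _, one_ne_zero, fun _ _ => trivial⟩
  sets_of_superset := fun ⟨b, hb, hx, h⟩ hU => ⟨b, hb, hx, fun y hy => hU (h y hy)⟩
  inter_sets := fun ⟨b, hb, hx, h⟩ ⟨b', hb', hx', h'⟩ => ⟨b * b', mul_mem hb hb',
    mul_ne_zero hx hx', fun y hy => ⟨h y (left_ne_zero_of_mul hy), h' y (right_ne_zero_of_mul hy)⟩⟩

theorem self_mem_of_mem_zariskiNhds {U : Set V} (hU : U ∈ zariskiNhds x) : x ∈ U :=
  let ⟨_, _, hx, hbU⟩ := hU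
  hbU x hx

theorem isOpen_ne_zero_of_mem_polyFun {b : V → ℂ} (hb : b ∈ polyFun V) :
    (affineSpace V).IsOpen {y | b y ≠ 0} :=
  fun _ hx => ⟨b, hb, hx, fun _ hy => hy⟩

theorem exists_isOpen_of_mem_zariskiNhds {U : Set V} (hU : U ∈ zariskiNhds x) :
    ∃ O ⊆ U, x ∈ O ∧ (affineSpace V).IsOpen O :=
  let ⟨_, hb, hx, hbU⟩ := hU
  ⟨_, hbU, hx, isOpen_ne_zero_of_mem_polyFun hb⟩

/-- The local ring of `V` at `x`: the functions which are quotients of polynomials near `x`. Its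
elements are functions rather than germs. -/
def regularAt (x : V) : Subalgebra ℂ (V → ℂ) where
  carrier := {f | ∃ a ∈ polyFun V, ∃ b ∈ polyFun V, b x ≠ 0 ∧ ∀ y, b y ≠ 0 → f y = a y / b y}
  mul_mem' := by
    rintro f g ⟨a, ha, b, hb, hx, hf⟩ ⟨a', ha', b', hb', hx', hg⟩
    refine ⟨a * a', mul_mem ha ha', b * b', mul_mem hb hb', mul_ne_zero hx hx', fun y hy => ?_⟩
    simp only [Pi.mul_apply, hf y (left_ne_zero_of_mul hy), hg y (right_ne_zero_of_mul hy),
      div_mul_div_comm]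
  add_mem' := by
    rintro f g ⟨a, ha, b, hb, hx, hf⟩ ⟨a', ha', b', hb', hx', hg⟩
    refine ⟨a * b' + b * a', add_mem (mul_mem ha hb') (mul_mem hb ha'), b * b', mul_mem hb hb',
      mul_ne_zero hx hx', fun y hy => ?_⟩
    have hy₁ := left_ne_zero_of_mul hy
    have hy₂ := right_ne_zero_of_mul hy
    simp only [Pi.add_apply, Pi.mul_apply, hf y hy₁, hg y hy₂, div_add_div _ _ hy₁ hy₂]
  algebraMap_mem' c := ⟨algebraMap ℂ _ c, Subalgebra.algebraMap_mem _ c, 1, one_mem _,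
    one_ne_zero, fun y _ => by simp⟩

theorem mem_regularAt_of_eventuallyEq {f g : V → ℂ} (hg : g ∈ regularAt x)
    (hfg : f =ᶠ[zariskiNhds x] g) : f ∈ regularAt x := by
  obtain ⟨a, ha, b, hb, hx, hg⟩ := hg
  obtain ⟨c, hc, hcx, hfg⟩ := hfg
  refine ⟨a * c, mul_mem ha hc, b * c, mul_mem hb hc, mul_ne_zero hx hcx, fun y hy => ?_⟩
  have hy₂ := right_ne_zero_of_mul hy
  exact (hfg y hy₂).trans <| (hg y (left_ne_zero_of_mul hy)).trans
    (mul_div_mul_right _ _ hy₂).symm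

theorem eventually_mem_regularAt {f : V → ℂ} (hf : f ∈ regularAt x) :
    ∀ᶠ y in zariskiNhds x, f ∈ regularAt y :=
  let ⟨a, ha, b, hb, hx, hf⟩ := hf
  ⟨b, hb, hx, fun _ hy => ⟨a, ha, b, hb, hy, hf⟩⟩

theorem eventually_ne_zero {f : V → ℂ} (hf : f ∈ regularAt x) (hfx : f x ≠ 0) :
    ∀ᶠ y in zariskiNhds x, f y ≠ 0 := by
  obtain ⟨a, ha, b, hb, hx, hf⟩ := hf
  rw [hf x hx] at hfx
  refine ⟨a * b, mul_mem ha hb, mul_ne_zero (div_ne_zero_iff.1 hfx).1 hx, fun y hy => ?_⟩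
  change f y ≠ 0
  rw [hf y (right_ne_zero_of_mul hy)]
  exact div_ne_zero (left_ne_zero_of_mul hy) (right_ne_zero_of_mul hy)

theorem inv_mem_regularAt {f : V → ℂ} (hf : f ∈ regularAt x) (hfx : f x ≠ 0) :
    f⁻¹ ∈ regularAt x := by
  obtain ⟨a, ha, b, hb, hx, hf⟩ := hf
  rw [hf x hx] at hfx
  refine mem_regularAt_of_eventuallyEq (g := b / a)
    ⟨b, hb, a, ha, (div_ne_zero_iff.1 hfx).1, fun _ _ => rfl⟩ ⟨b, hb, hx, fun y hy => ?_⟩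
  change (f y)⁻¹ = b y / a y
  rw [hf y hy, inv_div]

theorem isRegularOn_affineSpace_iff {U : Set V} (hU : (affineSpace V).IsOpen U) {f : V → ℂ} :
    (affineSpace V).IsRegularOn U f ↔ ∀ x ∈ U, f ∈ regularAt x := by
  refine forall₂_congr fun x hxU => ⟨?_, ?_⟩
  · rintro ⟨a, ha, b, hb, hx, hf⟩
    refine mem_regularAt_of_eventuallyEq (g := a / b) ⟨a, ha, b, hb, hx, fun _ _ => rfl⟩ ?_
    filter_upwards [hU x hxU, show ∀ᶠ y in zariskiNhds x, b y ≠ 0 from ⟨b, hb, hx, fun _ h => h⟩]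
      using hf
  · rintro ⟨a, ha, b, hb, hx, hf⟩
    exact ⟨a, ha, b, hb, hx, fun y _ hy => hf y hy⟩

theorem isSheaf_affineSpace : (affineSpace V).IsSheaf where
  isOpen_inter hU hU' x hx := inter_mem (f := zariskiNhds x) (hU x hx.1) (hU' x hx.2)
  isOpen_of_local hU x hx :=
    let ⟨_, hNU, hxN, hN⟩ := hU x hx
    mem_of_superset (f := zariskiNhds x) (hN x hxN) hNU
  isRegularOn_of_local hU hf := (isRegularOn_affineSpace_iff hU).2 fun x hx =>
    let ⟨_, hxN, hN, _, hh, hfh⟩ := hf x hx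
    mem_regularAt_of_eventuallyEq ((isRegularOn_affineSpace_iff hN).1 hh x hxN) <|
      mem_of_superset (inter_mem (hU x hx) (hN x hxN)) hfh

/-- A map to a vector space is regular at a point when its composites with linear forms are. -/
def IsRegularAt (s : V → E) (x : V) : Prop :=
  ∀ l : Module.Dual ℂ E, (fun y => l (s y)) ∈ regularAt x

theorem isRegularAt_iff_mem_regularAt {f : V → ℂ} : IsRegularAt f x ↔ f ∈ regularAt x :=
  ⟨fun hf => hf LinearMap.id, fun hf l => by
    have hl : (fun y => l (f y)) = l 1 • f := by ext y; simpa [mul_comm] using l.map_smul (f y) 1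
    exact hl ▸ Subalgebra.smul_mem _ hf _⟩

theorem isRegularAt_const (e : E) : IsRegularAt (fun _ => e) x := fun l =>
  Subalgebra.algebraMap_mem _ (l e)

theorem isRegularAt_linearMap (T : V →ₗ[ℂ] E) : IsRegularAt T x := fun l =>
  ⟨_, dual_mem_polyFun (l ∘ₗ T), 1, one_mem _, one_ne_zero, fun y _ => by simp⟩

namespace IsRegularAt

theorem linear {s : V → E} (hs : IsRegularAt s x) (T : E →ₗ[ℂ] E') :
    IsRegularAt (fun y => T (s y)) x := fun l => hs (l ∘ₗ T)

theorem add {s t : V → E} (hs : IsRegularAt s x) (ht : IsRegularAt t x) :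
    IsRegularAt (fun y => s y + t y) x := fun l => by
  simpa using! add_mem (hs l) (ht l)

theorem sub {s t : V → E} (hs : IsRegularAt s x) (ht : IsRegularAt t x) :
    IsRegularAt (fun y => s y - t y) x := fun l => by
  simpa using! sub_mem (hs l) (ht l)

theorem smul {c : V → ℂ} {s : V → E} (hc : c ∈ regularAt x) (hs : IsRegularAt s x) :
    IsRegularAt (fun y => c y • s y) x := fun l => by
  simpa using! mul_mem hc (hs l)

theorem sum {ι : Type*} {S : Finset ι} {s : ι → V → E} (hs : ∀ i ∈ S, IsRegularAt (s i) x) :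
    IsRegularAt (fun y => ∑ i ∈ S, s i y) x := fun l => by
  simpa [Finset.sum_fn] using! sum_mem fun i hi => hs i hi l

theorem prodMk {s : V → E} {t : V → E'} (hs : IsRegularAt s x) (ht : IsRegularAt t x) :
    IsRegularAt (fun y => (s y, t y)) x := by
  simpa using (hs.linear (LinearMap.inl ℂ E E')).add (ht.linear (LinearMap.inr ℂ E E'))

theorem of_basis {ι : Type*} [Finite ι] (b : Module.Basis ι ℂ E) {s : V → E}
    (hs : ∀ i, (fun y => b.repr (s y) i) ∈ regularAt x) : IsRegularAt s x := by
  have := Fintype.ofFinite ι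
  simpa only [b.sum_repr] using sum fun i (_ : i ∈ Finset.univ) =>
    smul (hs i) (isRegularAt_const (b i))

theorem bilinear [FiniteDimensional ℂ E] {s : V → E} {t : V → E'} (hs : IsRegularAt s x)
    (ht : IsRegularAt t x) (B : E →ₗ[ℂ] E' →ₗ[ℂ] E'') :
    IsRegularAt (fun y => B (s y) (t y)) x := by
  let b := Module.finBasis ℂ E
  have hB (y : V) : B (s y) (t y) = ∑ i, b.coord i (s y) • B (b i) (t y) := by
    conv_lhs => rw [← b.sum_repr (s y)]
    simp only [map_sum, map_smul, LinearMap.sum_apply, LinearMap.smul_apply,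
      Module.Basis.coord_apply]
  simpa only [hB] using sum fun i (_ : i ∈ Finset.univ) =>
    smul (hs (b.coord i)) (ht.linear (B (b i)))

theorem eventually [FiniteDimensional ℂ E] {s : V → E} (hs : IsRegularAt s x) :
    ∀ᶠ y in zariskiNhds x, IsRegularAt s y := by
  let b := Module.finBasis ℂ E
  filter_upwards [eventually_all.2 fun i => eventually_mem_regularAt (hs (b.coord i))] with y hy
  exact of_basis b hy

theorem comp_mem_of_mem_polyFun {s : V → W} (hs : IsRegularAt s x) {g : W → ℂ}
    (hg : g ∈ polyFun W) : g ∘ s ∈ regularAt x := by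
  induction hg using Algebra.adjoin_induction with
  | mem f hf => obtain ⟨l, rfl⟩ := hf; exact hs l
  | algebraMap c => exact Subalgebra.algebraMap_mem _ c
  | add f g _ _ hf hg => exact add_mem hf hg
  | mul f g _ _ hf hg => exact mul_mem hf hg

theorem tendsto {s : V → W} (hs : IsRegularAt s x) :
    Tendsto s (zariskiNhds x) (zariskiNhds (s x)) := fun _ ⟨_, hb, hx, hbU⟩ =>
  mem_of_superset (eventually_ne_zero (hs.comp_mem_of_mem_polyFun hb) hx) fun _ hy => hbU _ hy

theorem comp_mem {s : V → W} (hs : IsRegularAt s x) {g : W → ℂ} (hg : g ∈ regularAt (s x)) :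
    g ∘ s ∈ regularAt x := by
  obtain ⟨a, ha, b, hb, hx, hg⟩ := hg
  refine mem_regularAt_of_eventuallyEq (mul_mem (hs.comp_mem_of_mem_polyFun ha)
    (inv_mem_regularAt (hs.comp_mem_of_mem_polyFun hb) hx)) ?_
  filter_upwards [eventually_ne_zero (hs.comp_mem_of_mem_polyFun hb) hx] with y hy
  exact (hg _ hy).trans (div_eq_mul_inv _ _)

end IsRegularAt

theorem IsMorphism.isRegularAt_comp {X : Type} {𝒳 : SpaceWithFunctions X} (h𝒳 : 𝒳.IsSheaf)
    {φ : X → V} (hφ : IsMorphism 𝒳 (affineSpace V) φ) {s : V → W}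
    (hs : ∀ x, IsRegularAt s (φ x)) : IsMorphism 𝒳 (affineSpace W) (s ∘ φ) := by
  have hopen {U : Set W} (hU : (affineSpace W).IsOpen U) : 𝒳.IsOpen (s ∘ φ ⁻¹' U) := by
    refine h𝒳.isOpen_of_local fun x hx => ?_
    obtain ⟨O, hOU, hxO, hO⟩ := exists_isOpen_of_mem_zariskiNhds ((hs x).tendsto (hU _ hx))
    exact ⟨φ ⁻¹' O, Set.preimage_mono hOU, hxO, hφ.isOpen_preimage hO⟩
  refine ⟨hopen, fun {U f} hU hf => h𝒳.isRegularOn_of_local (hopen hU) fun x hx => ?_⟩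
  have hfs : f ∘ s ∈ regularAt (φ x) :=
    (hs x).comp_mem ((isRegularOn_affineSpace_iff hU).1 hf _ hx)
  obtain ⟨O, hfO, hxO, hO⟩ := exists_isOpen_of_mem_zariskiNhds (eventually_mem_regularAt hfs)
  exact ⟨φ ⁻¹' O, hxO, hφ.isOpen_preimage hO, _,
    hφ.isRegularOn_comp hO ((isRegularOn_affineSpace_iff hO).2 hfO), fun _ _ => rfl⟩

end Regular

/-! ### Regular families of linear systems -/

theorem isUnit_iff_norm_ne_zero {K R : Type*} [Field K] [Ring R] [Algebra K R]
    [FiniteDimensional K R] {a : R} : IsUnit a ↔ Algebra.norm K a ≠ 0 := by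
  rw [← Algebra.lmul_isUnit_iff (R := K), LinearMap.isUnit_iff_isUnit_det, isUnit_iff_ne_zero]
  rfl

section RegularAlgebra

variable {V : Type} [AddCommGroup V] [Module ℂ V] {x : V}

theorem det_mem_regularAt {n : Type*} [Fintype n] [DecidableEq n] {M : V → Matrix n n ℂ}
    (hM : ∀ i j, (fun y => M y i j) ∈ regularAt x) : (fun y => (M y).det) ∈ regularAt x := by
  have hdet : (fun y => (M y).det) =
      ∑ σ : Equiv.Perm n, Equiv.Perm.sign σ • ∏ i, fun y => M y (σ i) i := by
    ext y
    simp only [Matrix.det_apply, Finset.sum_apply, Pi.smul_apply, Finset.prod_apply]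
  rw [hdet]
  exact sum_mem (S := regularAt x) fun σ _ =>
    zsmul_mem (prod_mem (S := regularAt x) fun i _ => hM (σ i) i) _

variable {R : Type*} [Ring R] [Algebra ℂ R]

theorem IsRegularAt.leftMulMatrix_mem {ι : Type*} [Fintype ι] [DecidableEq ι]
    (b : Module.Basis ι ℂ R) {s : V → R} (hs : IsRegularAt s x) (i j : ι) :
    (fun y => Algebra.leftMulMatrix b (s y) i j) ∈ regularAt x := by
  simp only [Algebra.leftMulMatrix_eq_repr_mul]
  exact hs (b.coord i ∘ₗ LinearMap.mulRight ℂ (b j))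

variable [FiniteDimensional ℂ R]

theorem IsRegularAt.norm_mem {s : V → R} (hs : IsRegularAt s x) :
    (fun y => Algebra.norm ℂ (s y)) ∈ regularAt x := by
  let b := Module.finBasis ℂ R
  simp only [Algebra.norm_eq_matrix_det b]
  exact det_mem_regularAt (hs.leftMulMatrix_mem b)

theorem IsRegularAt.eventually_isUnit {s : V → R} (hs : IsRegularAt s x) (hx : IsUnit (s x)) :
    ∀ᶠ y in zariskiNhds x, IsUnit (s y) := by
  simp only [isUnit_iff_norm_ne_zero (K := ℂ)] at hx ⊢
  exact eventually_ne_zero hs.norm_mem hx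

theorem IsRegularAt.ringInverse {s : V → R} (hs : IsRegularAt s x) (hx : IsUnit (s x)) :
    IsRegularAt (fun y => Ring.inverse (s y)) x := by
  let b := Module.finBasis ℂ R
  let M (y : V) := Algebra.leftMulMatrix b (s y)
  have hM : ∀ i j, (fun y => M y i j) ∈ regularAt x := hs.leftMulMatrix_mem b
  refine .of_basis b fun i => ?_
  have hcramer : (fun y => (M y).det⁻¹ * (M y).cramer (b.repr 1) i) ∈ regularAt x := by
    refine mul_mem (inv_mem_regularAt (det_mem_regularAt hM) ?_) ?_
    · simpa only [M, ← Algebra.norm_eq_matrix_det] using isUnit_iff_norm_ne_zero.1 hx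
    · simp only [Matrix.cramer_apply]
      refine det_mem_regularAt fun k j => ?_
      rcases eq_or_ne j i with rfl | hji
      · simpa using isRegularAt_iff_mem_regularAt.1 (isRegularAt_const (b.repr 1 k))
      · simpa [hji] using hM k j
  refine mem_regularAt_of_eventuallyEq hcramer ?_
  filter_upwards [hs.eventually_isUnit hx] with y hy
  have hdet : IsUnit (M y).det := by
    simpa only [M, ← Algebra.norm_eq_matrix_det] using
      isUnit_iff_ne_zero.2 (isUnit_iff_norm_ne_zero.1 hy)
  have hsolve : (M y).mulVec (b.repr (Ring.inverse (s y))) = b.repr 1 := by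
    rw [Algebra.leftMulMatrix_mulVec_repr, Ring.mul_inverse_cancel _ hy]
  rw [← hsolve, Matrix.cramer_eq_adjugate_mulVec, Matrix.mulVec_mulVec, Matrix.adjugate_mul]
  simp [Matrix.smul_mulVec, inv_mul_cancel_left₀ hdet.ne_zero]

end RegularAlgebra

theorem exists_comp_comp_eq_self {K E F : Type*} [Field K] [AddCommGroup E] [Module K E]
    [AddCommGroup F] [Module K F] (f : E →ₗ[K] F) : ∃ g : F →ₗ[K] E, f ∘ₗ g ∘ₗ f = f := by
  obtain ⟨σ, hσ⟩ := f.rangeRestrict.exists_rightInverse_of_surjective f.range_rangeRestrict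
  obtain ⟨g, hg⟩ := LinearMap.exists_extend σ
  refine ⟨g, LinearMap.ext fun v => ?_⟩
  have hgf : g (f v) = σ (f.rangeRestrict v) := LinearMap.congr_fun hg (f.rangeRestrict v)
  have hfσ := congrArg Subtype.val (LinearMap.congr_fun hσ (f.rangeRestrict v))
  simpa [hgf] using hfσ

theorem IsRegularAt.exists_ker_section {V E E' : Type} [AddCommGroup V] [Module ℂ V]
    [AddCommGroup E] [Module ℂ E] [FiniteDimensional ℂ E] [AddCommGroup E'] [Module ℂ E']
    {x : V} {T : V → E →ₗ[ℂ] E'} (hT : IsRegularAt T x) {v : E} (hv : T x v = 0) :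
    ∃ s : V → E, IsRegularAt s x ∧ s x = v ∧ ∀ᶠ y in zariskiNhds x,
      Module.finrank ℂ (LinearMap.ker (T y)) = Module.finrank ℂ (LinearMap.ker (T x)) →
        T y (s y) = 0 := by
  obtain ⟨τ, hτ⟩ := exists_comp_comp_eq_self (T x)
  -- `F y` is the identity at `y = x`, hence invertible near `x`, and it maps `ker (T y)` into
  -- `ker (T x)`; the section is the inverse image of `v`.
  let F (y : V) : Module.End ℂ E := 1 - τ ∘ₗ T x + τ ∘ₗ T y
  have hFx : F x = 1 := sub_add_cancel _ _
  have hF : IsRegularAt F x := (isRegularAt_const _).add (hT.linear (LinearMap.llcomp ℂ E E' E τ))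
  have hunit : IsUnit (F x) := hFx ▸ isUnit_one
  refine ⟨fun y => Ring.inverse (F y) v, (hF.ringInverse hunit).linear (LinearMap.applyₗ v),
    by simp [hFx], ?_⟩
  filter_upwards [hF.eventually_isUnit hunit] with y hy hdim
  have hTF (w : E) : T x (F y w) = T x (τ (T y w)) := by
    have hτw : T x (τ (T x w)) = T x w := LinearMap.congr_fun hτ w
    simp [F, hτw]
  have hmap : (LinearMap.ker (T y)).map (F y) = LinearMap.ker (T x) := by
    refine Submodule.eq_of_le_of_finrank_eq ?_ ?_
    · rintro _ ⟨w, hw, rfl⟩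
      rw [LinearMap.mem_ker, hTF, LinearMap.mem_ker.1 hw, map_zero, map_zero]
    · rw [← hdim]
      have hinj : Function.Injective (F y) := ((Module.End.isUnit_iff _).1 hy).1
      exact (Submodule.equivMapOfInjective (F y) hinj _).finrank_eq.symm
  obtain ⟨w, hw, rfl⟩ : v ∈ (LinearMap.ker (T y)).map (F y) := hmap ▸ hv
  rw [← Module.End.mul_apply, Ring.inverse_mul_cancel _ hy]
  exact hw

section Conjugator

/-- The linear map `q ↦ q b - a q`; its kernel consists of the `q` with `SemiconjBy q b a`. -/
def intertwiner (K : Type*) [Field K] {R : Type*} [Ring R] [Algebra K R] (b a : R) : R →ₗ[K] R :=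
  LinearMap.mulRight K b - LinearMap.mulLeft K a

variable {K R : Type*} [Field K] [Ring R] [Algebra K R] {a b q : R}

theorem mem_ker_intertwiner : q ∈ LinearMap.ker (intertwiner K b a) ↔ SemiconjBy q b a := by
  rw [LinearMap.mem_ker]
  exact sub_eq_zero

theorem finrank_ker_intertwiner_of_isConj (h : IsConj b a) :
    Module.finrank K (LinearMap.ker (intertwiner K b a)) =
      Module.finrank K (LinearMap.ker (intertwiner K b b)) := by
  obtain ⟨g, hg⟩ := h
  have hker : LinearMap.ker (intertwiner K b a) =
      (LinearMap.ker (intertwiner K b b)).map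
        (DistribMulAction.toLinearEquiv K R g : R →ₗ[K] R) := by
    ext q
    rw [Submodule.mem_map_equiv, mem_ker_intertwiner, mem_ker_intertwiner]
    change _ ↔ SemiconjBy (↑g⁻¹ * q) b b
    refine ⟨hg.units_inv_symm_left.mul_left, fun hq => ?_⟩
    simpa using hg.mul_left hq
  rw [hker]
  exact LinearEquiv.finrank_map_eq _ _

theorem exists_isRegularAt_semiconjBy {R : Type} [Ring R] [Algebra ℂ R] [FiniteDimensional ℂ R]
    {a b : R} (h : IsConj b a) :
    ∃ q : R → R, IsRegularAt q a ∧
      ∀ᶠ y in zariskiNhds a, IsUnit (q y) ∧ (IsConj b y → SemiconjBy (q y) b y) := by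
  have hdim := finrank_ker_intertwiner_of_isConj (K := ℂ) h
  obtain ⟨g, hg⟩ := h
  have hT : IsRegularAt (intertwiner ℂ b) a :=
    (isRegularAt_const _).sub (isRegularAt_linearMap (LinearMap.mul ℂ R))
  obtain ⟨q, hq, hqa, hker⟩ := hT.exists_ker_section (mem_ker_intertwiner.2 hg)
  refine ⟨q, hq, ?_⟩
  filter_upwards [hq.eventually_isUnit (hqa ▸ g.isUnit), hker] with y hy hker
  exact ⟨hy, fun hby => mem_ker_intertwiner.1 <|
    hker ((finrank_ker_intertwiner_of_isConj hby).trans hdim.symm)⟩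

end Conjugator

/-! ### The dual of the Takiff algebra as the Takiff algebra -/

section Takiff

variable {m r : ℕ}

instance : FiniteDimensional ℂ (Takiff m r) :=
  inferInstanceAs (FiniteDimensional ℂ (Fin (r + 1) → Fin m → Fin m → ℂ))

instance : FiniteDimensional ℂ (TakiffDual m r) :=
  inferInstanceAs (FiniteDimensional ℂ (Fin (r + 1) → Fin m → Fin m → ℂ))

instance : FiniteDimensional ℂ (PhaseSpace m r) :=
  inferInstanceAs (FiniteDimensional ℂ (Takiff m r × TakiffDual m r))

noncomputable instance : Algebra ℂ (Takiff m r) :=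
  .ofModule (fun c g h => by ext1 k; simp [Takiff.coeff_mul, Finset.smul_sum])
    (fun c g h => by ext1 k; simp [Takiff.coeff_mul, Finset.smul_sum])

/-- `TakiffDual.shift`, multiplication by `z ^ (r+1)`, as a linear isomorphism. -/
def shiftEquiv (m r : ℕ) : TakiffDual m r ≃ₗ[ℂ] Takiff m r where
  toFun A := A.shift
  invFun B := fun i => B i.rev
  map_add' _ _ := rfl
  map_smul' _ _ := rfl
  left_inv A := funext fun i => congrArg A (Fin.rev_rev i)
  right_inv B := funext fun i => congrArg B (Fin.rev_rev i)

@[simp] theorem shiftEquiv_apply (A : TakiffDual m r) : shiftEquiv m r A = A.shift := rfl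

@[simp] theorem shift_shiftEquiv_symm (B : Takiff m r) : ((shiftEquiv m r).symm B).shift = B :=
  (shiftEquiv m r).apply_symm_apply B

@[simp] theorem shift_zero : (0 : TakiffDual m r).shift = 0 := rfl

theorem coeff_shift_rev (A : TakiffDual m r) (i : Fin (r + 1)) :
    A.shift.coeff i.rev = A.coeff i :=
  congrArg A (Fin.rev_rev i)

theorem shift_piMinus_mul_right (A : TakiffDual m r) (h : Takiff m r) :
    (piMinus r (A.toLaurent * h.toLaurent)).shift = A.shift * h := by
  simpa [Takiff.toLaurent_one] using shift_piMinus_mul_mul 1 A h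

theorem shift_momentInner (x : PhaseSpace m r) : (momentInner x).shift = x.P.shift * x.Q :=
  shift_piMinus_mul_right _ _

theorem shift_matA (x : PhaseSpace m r) : (matA x).shift = x.Q * x.P.shift :=
  shift_piMinus_mul _ _

theorem shift_coadjoint (g : TakiffGroup m r) (A : TakiffDual m r) :
    (g • A).shift = g * A.shift * (g⁻¹ : TakiffGroup m r) :=
  shift_piMinus_mul_mul _ _ _

theorem shift_coad (A : TakiffDual m r) (ξ : Takiff m r) :
    (coad A ξ).shift = ξ * A.shift - A.shift * ξ :=
  (map_sub (shiftEquiv m r) (piMinus r (ξ.toLaurent * A.toLaurent))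
    (piMinus r (A.toLaurent * ξ.toLaurent))).trans <|
    congrArg₂ _ (shift_piMinus_mul _ _) (shift_piMinus_mul_right _ _)

theorem Q_smul (g : TakiffGroup m r) (x : PhaseSpace m r) :
    (g • x).Q = x.Q * (g⁻¹ : TakiffGroup m r) := rfl

theorem shift_P_smul (g : TakiffGroup m r) (x : PhaseSpace m r) :
    (g • x).P.shift = g * x.P.shift := shift_piMinus_mul _ _

theorem Q_innerInf (x : PhaseSpace m r) (ξ : Takiff m r) : (innerInf x ξ).Q = -(x.Q * ξ) := rfl

theorem shift_P_innerInf (x : PhaseSpace m r) (ξ : Takiff m r) :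
    (innerInf x ξ).P.shift = ξ * x.P.shift := shift_piMinus_mul _ _

theorem mem_orbit_iff_isConj {A L : TakiffDual m r} :
    A ∈ MulAction.orbit (TakiffGroup m r) L ↔ IsConj L.shift A.shift := by
  refine exists_congr fun g => ?_
  rw [← TakiffDual.shift_injective.eq_iff, shift_coadjoint, SemiconjBy, Units.mul_inv_eq_iff_eq_mul]

theorem isUnit_shift_iff {A : TakiffDual m r} :
    IsUnit A.shift ↔ IsUnit (A.coeff (Fin.last r)) := by
  rw [Takiff.isUnit_iff, ← coeff_shift_rev, Fin.rev_last]

/-- The linear form `g ↦ Tr (g r)`, the residue at `0` of `z ^ (-r-1) Tr (g z) dz`. -/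
noncomputable def traceForm (m r : ℕ) : Takiff m r →ₗ[ℂ] ℂ where
  toFun g := (g.coeff (Fin.last r)).trace
  map_add' g h := by simp
  map_smul' c g := by simp

theorem traceForm_mul_comm (g h : Takiff m r) :
    traceForm m r (g * h) = traceForm m r (h * g) := by
  change ((g * h).coeff _).trace = ((h * g).coeff _).trace
  rw [Takiff.coeff_mul, Takiff.coeff_mul, Finset.sum_comm]
  simp only [Matrix.trace_sum, apply_ite Matrix.trace]
  refine Finset.sum_congr rfl fun i _ => Finset.sum_congr rfl fun j _ => ?_
  rw [Matrix.trace_mul_comm, add_comm]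

theorem pairing_eq_traceForm (A : TakiffDual m r) (B : Takiff m r) :
    pairing A B = traceForm m r (A.shift * B) := by
  change _ = ((A.shift * B).coeff _).trace
  rw [Takiff.coeff_mul, Finset.sum_comm, Matrix.trace_sum]
  refine Finset.sum_congr rfl fun j _ => ?_
  have hrev (i : Fin (r + 1)) : (i : ℕ) + j = Fin.last r ↔ i = j.rev := by
    rw [Fin.ext_iff, Fin.val_rev, Fin.val_last]
    omega
  simp only [hrev, Finset.sum_ite_eq', Finset.mem_univ, if_true, coeff_shift_rev]

theorem eq_zero_of_forall_pairing_eq_zero {A : TakiffDual m r} (hA : ∀ B, pairing A B = 0) :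
    A = 0 := by
  ext1 i
  refine Matrix.ext_iff_trace_mul_right.2 fun M => ?_
  have hM : pairing A (Pi.single i M) = (A.coeff i * M).trace := by
    refine (Fintype.sum_eq_single i fun j hj => ?_).trans ?_ <;>
      simp_all [Takiff.coeff]
  change (A.coeff i * M).trace = ((0 : Mat m) * M).trace
  rw [zero_mul, Matrix.trace_zero]
  exact hM.symm.trans (hA _)

theorem sum_ite_add_eq_rev {M : Type*} [AddCommMonoid M] (f : Fin (r + 1) → Fin (r + 1) → M)
    (k : Fin (r + 1)) :
    (∑ i : Fin (r + 1), ∑ j : Fin (r + 1), if (i : ℕ) + j = k.rev then f i j.rev else 0) =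
      ∑ i : Fin (r - k + 1), f (i.castLE (by omega)) ((i.addNat k).castLE (by omega)) := by
  have hle : r - k + 1 ≤ r + 1 := by omega
  symm
  refine Fintype.sum_of_injective _ (Fin.castLE_injective hle) _ _ (fun i hi => ?_)
    (fun i => ?_)
  · refine Finset.sum_eq_zero fun j _ => if_neg fun h => hi ⟨⟨i, ?_⟩, rfl⟩
    rw [Fin.val_rev] at h
    omega
  · have hle' : r - k + 1 + k ≤ r + 1 := by omega
    have hrev (j : Fin (r + 1)) : (i : ℕ) + j = k.rev ↔ j = ((i.addNat k).castLE hle').rev := by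
      simp only [Fin.ext_iff, Fin.val_rev, Fin.val_castLE, Fin.val_addNat]
      omega
    simp only [Fin.val_castLE, hrev, Finset.sum_ite_eq', Finset.mem_univ, if_true, Fin.rev_rev]

theorem coeff_matA (x : PhaseSpace m r) (k : Fin (r + 1)) :
    (matA x).coeff k =
      ∑ i : Fin (r - k + 1),
        x.Q.coeff (i.castLE (by omega)) * x.P.coeff ((i.addNat k).castLE (by omega)) := by
  rw [← coeff_shift_rev, shift_matA, Takiff.coeff_mul]
  exact sum_ite_add_eq_rev (fun i j => x.Q.coeff i * x.P.coeff j) k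

theorem coeff_momentInner (x : PhaseSpace m r) (k : Fin (r + 1)) :
    (momentInner x).coeff k =
      ∑ i : Fin (r - k + 1),
        x.P.coeff ((i.addNat k).castLE (by omega)) * x.Q.coeff (i.castLE (by omega)) := by
  rw [← coeff_shift_rev, shift_momentInner, Takiff.coeff_mul, Finset.sum_comm]
  simp only [fun i j : Fin (r + 1) => add_comm (i : ℕ) (j : ℕ)]
  exact sum_ite_add_eq_rev (fun i j => x.P.coeff j * x.Q.coeff i) k

end Takiff

/-! ### The inner and the outer action -/

section DualPair

theorem fderiv_bilinear_apply {𝕜 E F G : Type*} [NontriviallyNormedField 𝕜] [CompleteSpace 𝕜]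
    [NormedAddCommGroup E] [NormedSpace 𝕜 E] [FiniteDimensional 𝕜 E]
    [NormedAddCommGroup F] [NormedSpace 𝕜 F] [FiniteDimensional 𝕜 F]
    [NormedAddCommGroup G] [NormedSpace 𝕜 G] (B : E →ₗ[𝕜] F →ₗ[𝕜] G) (p v : E × F) :
    fderiv 𝕜 (fun q : E × F => B q.1 q.2) p v = B v.1 p.2 + B p.1 v.2 := by
  have hB := B.toContinuousBilinearMap.hasFDerivAt_of_bilinear
    (hasFDerivAt_fst (𝕜 := 𝕜) (p := p)) hasFDerivAt_snd
  exact (DFunLike.congr_fun hB.fderiv v).trans (add_comm _ _)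

variable {m r : ℕ}

theorem shift_fderiv_apply {f : PhaseSpace m r → TakiffDual m r}
    (B : Takiff m r →ₗ[ℂ] Takiff m r →ₗ[ℂ] Takiff m r)
    (hf : ∀ y, (f y).shift = B y.Q y.P.shift) (x v : PhaseSpace m r) :
    (fderiv ℂ f x v).shift = B v.Q x.P.shift + B x.Q v.P.shift := by
  let B' : Takiff m r →ₗ[ℂ] TakiffDual m r →ₗ[ℂ] TakiffDual m r :=
    (B.compl₂ (shiftEquiv m r).toLinearMap).compr₂ (shiftEquiv m r).symm.toLinearMap
  have hfB : f = fun y => B' y.Q y.P := funext fun y =>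
    ((shiftEquiv m r).eq_symm_apply).2 (hf y)
  -- The differential depends only on the topology, which is that of the sup norm.
  have hfderiv : fderiv ℂ (fun y : PhaseSpace m r => B' y.Q y.P) x v = B' v.Q x.P + B' x.Q v.P :=
    fderiv_bilinear_apply (E := Fin (r + 1) → Fin m → Fin m → ℂ)
      (F := Fin (r + 1) → Fin m → Fin m → ℂ) (G := Fin (r + 1) → Fin m → Fin m → ℂ) B' x v
  rw [hfB, hfderiv, ← shiftEquiv_apply, map_add]
  exact congrArg₂ _ (shift_shiftEquiv_symm _) (shift_shiftEquiv_symm _)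

theorem shift_dA (x v : PhaseSpace m r) :
    (dA x v).shift = v.Q * x.P.shift + x.Q * v.P.shift :=
  shift_fderiv_apply (LinearMap.mul ℂ (Takiff m r)) shift_matA x v

theorem shift_dMoment (x v : PhaseSpace m r) :
    (dMoment x v).shift = x.P.shift * v.Q + v.P.shift * x.Q :=
  shift_fderiv_apply (LinearMap.mul ℂ (Takiff m r)).flip shift_momentInner x v

theorem omega_eq_traceForm (u v : PhaseSpace m r) :
    omega u v = traceForm m r (u.P.shift * v.Q) - traceForm m r (v.P.shift * u.Q) := by
  rw [omega, pairing_eq_traceForm, pairing_eq_traceForm]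

theorem traceForm_shift_P_smul_mul_Q_smul (g : TakiffGroup m r) (u v : PhaseSpace m r) :
    traceForm m r ((g • u).P.shift * (g • v).Q) = traceForm m r (u.P.shift * v.Q) := by
  rw [shift_P_smul, Q_smul, ← mul_assoc, traceForm_mul_comm, mul_assoc, Units.inv_mul_cancel_left]

theorem innerActionIsHamiltonian (m r : ℕ) : InnerActionIsHamiltonian m r where
  symplectic g u v := by
    rw [omega_eq_traceForm, omega_eq_traceForm, traceForm_shift_P_smul_mul_Q_smul,
      traceForm_shift_P_smul_mul_Q_smul]
  moment ξ x v := by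
    rw [omega_eq_traceForm, pairing_eq_traceForm, shift_dMoment, Q_innerInf, shift_P_innerInf,
      mul_neg, map_neg, sub_neg_eq_add, mul_assoc, traceForm_mul_comm, ← mul_assoc, ← map_add,
      ← add_mul]
  equivariant g x := by
    apply TakiffDual.shift_injective
    rw [shift_coadjoint, shift_momentInner, shift_momentInner, shift_P_smul, Q_smul]
    simp only [mul_assoc]

/-- The identification of the phase space with `R × R`, where `R` is the Takiff algebra, by
`(Q, P) ↦ (Q, z ^ (r+1) P)`. -/
noncomputable def phaseSpaceEquiv (m r : ℕ) : PhaseSpace m r ≃ₗ[ℂ] Takiff m r × Takiff m r :=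
  (LinearEquiv.refl ℂ (Takiff m r)).prodCongr (shiftEquiv m r)

@[simp] theorem Q_phaseSpaceEquiv_symm (p : Takiff m r × Takiff m r) :
    ((phaseSpaceEquiv m r).symm p).Q = p.1 := rfl

@[simp] theorem shift_P_phaseSpaceEquiv_symm (p : Takiff m r × Takiff m r) :
    ((phaseSpaceEquiv m r).symm p).P.shift = p.2 := shift_shiftEquiv_symm p.2

theorem PhaseSpace.ext_shift {x y : PhaseSpace m r} (hQ : x.Q = y.Q)
    (hP : x.P.shift = y.P.shift) : x = y :=
  PhaseSpace.ext hQ (TakiffDual.shift_injective hP)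

/-- The infinitesimal action at `x = (Q, P)` of the outer action `g • (Q, P) = (g Q, P g⁻¹)`, that
is, `ξ ↦ (ξ Q, -P ξ)`. -/
noncomputable def outerInf (x : PhaseSpace m r) : Takiff m r →ₗ[ℂ] PhaseSpace m r :=
  (phaseSpaceEquiv m r).symm.toLinearMap ∘ₗ
    (LinearMap.mulRight ℂ x.Q).prod (-LinearMap.mulLeft ℂ x.P.shift)

@[simp] theorem Q_outerInf (x : PhaseSpace m r) (ξ : Takiff m r) : (outerInf x ξ).Q = ξ * x.Q :=
  rfl

@[simp] theorem shift_P_outerInf (x : PhaseSpace m r) (ξ : Takiff m r) :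
    (outerInf x ξ).P.shift = -(x.P.shift * ξ) :=
  shift_P_phaseSpaceEquiv_symm _

theorem dMoment_innerInf (x : PhaseSpace m r) (ξ : Takiff m r) :
    dMoment x (innerInf x ξ) = coad (momentInner x) ξ := by
  apply TakiffDual.shift_injective
  rw [shift_dMoment, shift_coad, shift_momentInner, Q_innerInf, shift_P_innerInf]
  noncomm_ring

theorem dA_innerInf (x : PhaseSpace m r) (ξ : Takiff m r) : dA x (innerInf x ξ) = 0 := by
  apply TakiffDual.shift_injective
  rw [shift_dA, shift_zero, Q_innerInf, shift_P_innerInf]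
  noncomm_ring

theorem dMoment_outerInf (x : PhaseSpace m r) (ξ : Takiff m r) :
    dMoment x (outerInf x ξ) = 0 := by
  apply TakiffDual.shift_injective
  rw [shift_dMoment, shift_zero, Q_outerInf, shift_P_outerInf]
  noncomm_ring

theorem dA_outerInf (x : PhaseSpace m r) (ξ : Takiff m r) :
    dA x (outerInf x ξ) = coad (matA x) ξ := by
  apply TakiffDual.shift_injective
  rw [shift_dA, shift_coad, shift_matA, Q_outerInf, shift_P_outerInf]
  noncomm_ring

theorem omega_outerInf (x v : PhaseSpace m r) (ξ : Takiff m r) :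
    omega v (outerInf x ξ) = pairing (dA x v) ξ := by
  rw [omega_eq_traceForm, pairing_eq_traceForm, shift_dA, Q_outerInf, shift_P_outerInf, neg_mul,
    map_neg, sub_neg_eq_add, traceForm_mul_comm, mul_assoc, mul_assoc,
    traceForm_mul_comm x.P.shift, ← map_add, mul_assoc, ← mul_add, add_comm (x.Q * _),
    traceForm_mul_comm]

/-- One of `Q` and `P` is invertible: the points of the phase space where the inner and the outer
action form a dual pair. -/
def IsNondegeneratePoint (x : PhaseSpace m r) : Prop := IsUnit x.Q ∨ IsUnit x.P.shift

namespace IsNondegeneratePoint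

variable {x : PhaseSpace m r}

theorem surjective_dMoment (hx : IsNondegeneratePoint x) : Function.Surjective (dMoment x) := by
  intro C
  obtain ⟨a, ha⟩ | ⟨b, hb⟩ := hx
  · refine ⟨(phaseSpaceEquiv m r).symm (0, C.shift * ↑a⁻¹), TakiffDual.shift_injective ?_⟩
    simp [shift_dMoment, ← ha]
  · refine ⟨(phaseSpaceEquiv m r).symm (↑b⁻¹ * C.shift, 0), TakiffDual.shift_injective ?_⟩
    simp [shift_dMoment, ← hb]

theorem ker_dMoment (hx : IsNondegeneratePoint x) :
    LinearMap.ker (dMoment x) = LinearMap.range (outerInf x) := by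
  refine le_antisymm (fun v hv => ?_) ?_
  · have hv' : x.P.shift * v.Q + v.P.shift * x.Q = 0 := by
      rw [← shift_dMoment, LinearMap.mem_ker.1 hv, shift_zero]
    obtain ⟨a, ha⟩ | ⟨b, hb⟩ := hx
    · refine ⟨v.Q * ↑a⁻¹, PhaseSpace.ext_shift (by simp [← ha]) ?_⟩
      simp [← mul_assoc, eq_neg_of_add_eq_zero_left hv', ← ha]
    · refine ⟨-(↑b⁻¹ * v.P.shift), PhaseSpace.ext_shift ?_ ?_⟩
      · rw [Q_outerInf, neg_mul, mul_assoc, eq_neg_of_add_eq_zero_right hv', ← hb, mul_neg,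
          neg_neg, Units.inv_mul_cancel_left]
      · rw [shift_P_outerInf, ← hb, mul_neg, neg_neg, Units.mul_inv_cancel_left]
  · rintro _ ⟨ξ, rfl⟩
    exact dMoment_outerInf x ξ

theorem ker_dA (hx : IsNondegeneratePoint x) :
    LinearMap.ker (dA x) = LinearMap.range (innerInf x) := by
  refine le_antisymm (fun v hv => ?_) ?_
  · have hv' : v.Q * x.P.shift + x.Q * v.P.shift = 0 := by
      rw [← shift_dA, LinearMap.mem_ker.1 hv, shift_zero]
    obtain ⟨a, ha⟩ | ⟨b, hb⟩ := hx
    · refine ⟨-(↑a⁻¹ * v.Q), PhaseSpace.ext_shift ?_ ?_⟩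
      · rw [Q_innerInf, ← ha, mul_neg, neg_neg, Units.mul_inv_cancel_left]
      · rw [shift_P_innerInf, neg_mul, mul_assoc, eq_neg_of_add_eq_zero_left hv', ← ha, mul_neg,
          neg_neg, Units.inv_mul_cancel_left]
    · refine ⟨v.P.shift * ↑b⁻¹, PhaseSpace.ext_shift ?_ ?_⟩
      · simp [Q_innerInf, ← mul_assoc, eq_neg_of_add_eq_zero_right hv', ← hb]
      · simp [shift_P_innerInf, ← hb]
  · rintro _ ⟨ξ, rfl⟩
    exact dA_innerInf x ξ

end IsNondegeneratePoint

end DualPair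

/-! ### The symplectic forms -/

section Symplectic

theorem exists_bilinForm_range {K E F : Type*} [Field K] [AddCommGroup E] [Module K E]
    [AddCommGroup F] [Module K F] (T : E →ₗ[K] F) (B : F →ₗ[K] E →ₗ[K] K)
    (hskew : ∀ ξ η, B (T ξ) η = -B (T η) ξ) (hsep : ∀ C, (∀ η, B C η = 0) → C = 0) :
    ∃ ω : LinearMap.BilinForm K (LinearMap.range T), ω.Nondegenerate ∧
      ∀ C η, ω C ⟨T η, η, rfl⟩ = B C η := by
  obtain ⟨σ, hσ⟩ := T.rangeRestrict.exists_rightInverse_of_surjective T.range_rangeRestrict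
  have hTσ (D : LinearMap.range T) : T (σ D) = D :=
    congrArg Subtype.val (LinearMap.congr_fun hσ D)
  have hω (C : LinearMap.range T) (η : E) : B C (σ ⟨T η, η, rfl⟩) = B C η := by
    obtain ⟨_, ξ, rfl⟩ := C
    rw [hskew, hTσ, ← hskew]
  refine ⟨B.compl₁₂ (LinearMap.range T).subtype σ, ⟨fun C hC => ?_, fun D hD => ?_⟩, hω⟩
  · exact Subtype.ext (hsep C fun η => (hω C η).symm.trans (hC _))
  · refine Subtype.ext (hsep D fun ξ => ?_)
    rw [← hTσ D, hskew, neg_eq_zero]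
    exact hD ⟨T ξ, ξ, rfl⟩

variable {m r : ℕ}

/-- `pairing` as a bilinear map. -/
noncomputable def pairingForm (m r : ℕ) : TakiffDual m r →ₗ[ℂ] Takiff m r →ₗ[ℂ] ℂ :=
  (LinearMap.mul ℂ (Takiff m r)).compr₂ (traceForm m r) ∘ₗ (shiftEquiv m r).toLinearMap

theorem pairingForm_apply (A : TakiffDual m r) (B : Takiff m r) :
    pairingForm m r A B = pairing A B :=
  (pairing_eq_traceForm A B).symm

theorem pairing_coad (A : TakiffDual m r) (ξ η : Takiff m r) :
    pairing (coad A ξ) η = -pairing A (ξ * η - η * ξ) := by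
  rw [pairing_eq_traceForm, pairing_eq_traceForm, shift_coad, sub_mul, mul_sub, map_sub, map_sub,
    neg_sub, mul_assoc ξ, traceForm_mul_comm ξ]
  simp only [mul_assoc]

theorem exists_kksForm (A : TakiffDual m r) :
    ∃ K : LinearMap.BilinForm ℂ (orbitTangent A), K.Nondegenerate ∧
      ∀ C η, K C ⟨coad A η, η, rfl⟩ = pairing C η := by
  simp only [← pairingForm_apply]
  refine exists_bilinForm_range (coad A) (pairingForm m r) (fun ξ η => ?_) fun C hC =>
    eq_zero_of_forall_pairing_eq_zero fun η => (pairingForm_apply C η).symm.trans (hC η)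
  rw [pairingForm_apply, pairingForm_apply, pairing_coad, pairing_coad, ← pairingForm_apply,
    ← pairingForm_apply, ← neg_sub (ξ * η), map_neg, neg_neg]

theorem IsNondegeneratePoint.exists_reducedTangent_equiv {x : PhaseSpace m r}
    (hx : IsNondegeneratePoint x) :
    ∃ Φ : reducedTangent x ≃ₗ[ℂ] orbitTangent (matA x),
      ∀ u : levelTangent x, (Φ (Submodule.Quotient.mk u) : TakiffDual m r) = dA x u := by
  let T := (dA x).domRestrict (levelTangent x)
  have hker : (stabTangent x).comap (levelTangent x).subtype = LinearMap.ker T := by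
    ext ⟨v, hv⟩
    have hmem : v ∈ stabTangent x ↔ v ∈ LinearMap.ker (dA x) := by
      rw [hx.ker_dA]
      refine ⟨fun ⟨ζ, _, hζ⟩ => ⟨ζ, hζ⟩, ?_⟩
      rintro ⟨ζ, rfl⟩
      exact ⟨ζ, (dMoment_innerInf x ζ).symm.trans hv, rfl⟩
    exact hmem
  have hrange : LinearMap.range T = orbitTangent (matA x) := by
    have hcomp : dA x ∘ₗ outerInf x = coad (matA x) := LinearMap.ext (dA_outerInf x)
    rw [LinearMap.range_domRestrict, levelTangent, hx.ker_dMoment, ← LinearMap.range_comp, hcomp,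
      orbitTangent]
  exact ⟨(Submodule.quotEquivOfEq _ _ hker).trans
    (T.quotKerEquivRange.trans (LinearEquiv.ofEq _ _ hrange)), fun _ => rfl⟩

theorem IsNondegeneratePoint.exists_reducedForm {x : PhaseSpace m r}
    (hx : IsNondegeneratePoint x) :
    ∃ (Ω : LinearMap.BilinForm ℂ (reducedTangent x))
      (K : LinearMap.BilinForm ℂ (orbitTangent (matA x)))
      (Φ : reducedTangent x ≃ₗ[ℂ] orbitTangent (matA x)),
      IsReducedForm x Ω ∧ Ω.Nondegenerate ∧ IsKKSForm (matA x) K ∧ K.Nondegenerate ∧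
      (∀ u : levelTangent x, (Φ (Submodule.Quotient.mk u) : TakiffDual m r) = dA x u) ∧
      ∀ a b : reducedTangent x, K (Φ a) (Φ b) = Ω a b := by
  obtain ⟨K, hKnondeg, hK⟩ := exists_kksForm (matA x)
  obtain ⟨Φ, hΦ⟩ := hx.exists_reducedTangent_equiv
  refine ⟨LinearMap.BilinForm.congr Φ.symm K, K, Φ, fun u v => ?_,
    (LinearMap.BilinForm.nondegenerate_congr_iff _).2 hKnondeg,
    fun ξ η => (hK _ η).trans (pairing_coad _ ξ η), hKnondeg, hΦ, fun _ _ => rfl⟩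
  obtain ⟨η, hη⟩ : v.1 ∈ LinearMap.range (outerInf x) := hx.ker_dMoment ▸ v.2
  have hΦv : Φ (Submodule.Quotient.mk v) = ⟨coad (matA x) η, η, rfl⟩ :=
    Subtype.ext (by rw [hΦ, ← hη, dA_outerInf])
  change K (Φ (Submodule.Quotient.mk u)) (Φ (Submodule.Quotient.mk v)) = omega u.1 v.1
  rw [hΦv, hK, hΦ, ← hη, omega_outerInf]

end Symplectic

/-! ### The reduction and the coadjoint orbit -/

section Reduction

variable {m r : ℕ} {L : TakiffDual m r}

theorem isRegularAt_Q (x : PhaseSpace m r) : IsRegularAt PhaseSpace.Q x :=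
  isRegularAt_linearMap (LinearMap.fst ℂ _ _ ∘ₗ (phaseSpaceEquiv m r).toLinearMap)

theorem isRegularAt_shift_P (x : PhaseSpace m r) :
    IsRegularAt (fun y : PhaseSpace m r => y.P.shift) x :=
  isRegularAt_linearMap (LinearMap.snd ℂ _ _ ∘ₗ (phaseSpaceEquiv m r).toLinearMap)

theorem isRegularAt_matA (x : PhaseSpace m r) : IsRegularAt matA x := by
  have hshift := (isRegularAt_Q x).bilinear (isRegularAt_shift_P x) (LinearMap.mul ℂ (Takiff m r))
  have hmatA : (matA : PhaseSpace m r → TakiffDual m r) =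
      fun y => (shiftEquiv m r).symm (y.Q * y.P.shift) :=
    funext fun y => (LinearEquiv.eq_symm_apply _).2 (shift_matA y)
  exact hmatA ▸ hshift.linear (shiftEquiv m r).symm.toLinearMap

theorem isSheaf_reductionSpace (L : TakiffDual m r) : (reductionSpace L).IsSheaf :=
  (isSheaf_affineSpace.sub _).quotient _

theorem isMorphism_reducedMap (L : TakiffDual m r) :
    IsMorphism (reductionSpace L) (affineSpace (TakiffDual m r)) (reducedMap L) :=
  .of_comp_quotientMk <| (IsMorphism.val (levelSet L)).isRegularAt_comp (isSheaf_affineSpace.sub _)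
    fun x => isRegularAt_matA x.1

theorem IsNondegeneratePoint.matA_mem_orbit {x : PhaseSpace m r} (hx : IsNondegeneratePoint x) :
    matA x ∈ MulAction.orbit (TakiffGroup m r) (momentInner x) := by
  rw [mem_orbit_iff_isConj, shift_momentInner, shift_matA]
  obtain ⟨a, ha⟩ | ⟨b, hb⟩ := hx
  · exact ⟨a, by simp only [SemiconjBy, ha, mul_assoc]⟩
  · refine ⟨b⁻¹, ?_⟩
    rw [SemiconjBy, ← hb, Units.inv_mul_cancel_left, Units.mul_inv_cancel_right]

theorem exists_smul_eq_of_isUnit_Q {x y : PhaseSpace m r} (hx : IsUnit x.Q) (hy : IsUnit y.Q)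
    (hA : matA x = matA y) : ∃ g : TakiffGroup m r, g • y = x := by
  obtain ⟨a, ha⟩ := hx
  obtain ⟨b, hb⟩ := hy
  have hPQ : a * x.P.shift = b * y.P.shift := by rw [ha, hb, ← shift_matA, hA, shift_matA]
  refine ⟨a⁻¹ * b, PhaseSpace.ext_shift ?_ ?_⟩
  · rw [Q_smul, ← ha, ← hb, mul_inv_rev, inv_inv, Units.val_mul, Units.mul_inv_cancel_left]
  · rw [shift_P_smul, Units.val_mul, mul_assoc, ← hPQ, Units.inv_mul_cancel_left]

theorem exists_smul_eq_of_isUnit_shift_P {x y : PhaseSpace m r} (hx : IsUnit x.P.shift)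
    (hy : IsUnit y.P.shift) (hA : matA x = matA y) : ∃ g : TakiffGroup m r, g • y = x := by
  obtain ⟨a, ha⟩ := hx
  obtain ⟨b, hb⟩ := hy
  have hQP : x.Q * a = y.Q * b := by rw [ha, hb, ← shift_matA, hA, shift_matA]
  refine ⟨a * b⁻¹, PhaseSpace.ext_shift ?_ ?_⟩
  · rw [Q_smul, mul_inv_rev, inv_inv, Units.val_mul, ← mul_assoc, ← hQP, Units.mul_inv_cancel_right]
  · rw [shift_P_smul, ← ha, ← hb, Units.val_mul, Units.inv_mul_cancel_right]

theorem injOn_reducedMap {D : Set (Reduction L)} (hD : ∀ x y : levelSet L,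
      Quotient.mk (reductionSetoid L) x ∈ D → Quotient.mk (reductionSetoid L) y ∈ D →
      matA x.1 = matA y.1 → ∃ g : TakiffGroup m r, g • y.1 = x.1) :
    Set.InjOn (reducedMap L) D := by
  rintro ⟨x⟩ hx ⟨y⟩ hy hxy
  obtain ⟨g, hg⟩ := hD x y hx hy hxy
  refine Quotient.sound ⟨⟨g, ?_⟩, hg⟩
  have hequiv := (innerActionIsHamiltonian m r).equivariant g y
  rw [hg, x.2, y.2] at hequiv
  exact hequiv.symm

/-- A regular local section near `a` of the map `(Q, P) ↦ A`, over the coadjoint orbit of `L`,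
with values in the part `U` of the level set of `L`. -/
structure IsLocalSection (L : TakiffDual m r) (U : Set (PhaseSpace m r)) (a : TakiffDual m r)
    (s : TakiffDual m r → PhaseSpace m r) : Prop where
  isRegularAt : IsRegularAt s a
  eventually : ∀ᶠ y in zariskiNhds a, y ∈ MulAction.orbit (TakiffGroup m r) L →
    momentInner (s y) = L ∧ s y ∈ U ∧ matA (s y) = y

theorem isBiregular_reducedMap {D : Set (Reduction L)} {U : Set (PhaseSpace m r)}
    (hD : ∀ x : levelSet L, Quotient.mk (reductionSetoid L) x ∈ D ↔ x.1 ∈ U)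
    (hmaps : Set.MapsTo (reducedMap L) D (MulAction.orbit (TakiffGroup m r) L))
    (hinj : Set.InjOn (reducedMap L) D)
    (hsec : ∀ a ∈ MulAction.orbit (TakiffGroup m r) L, ∃ s, IsLocalSection L U a s) :
    IsBiregular ((reductionSpace L).sub D) (orbitSpace L) (hmaps.restrict (reducedMap L) D _) := by
  refine .of_local_sections (isSheaf_affineSpace.sub _)
    (.of_val_comp ((isSheaf_reductionSpace L).sub D)
      ((isMorphism_reducedMap L).comp (.val D))) ((Set.MapsTo.restrict_inj hmaps).2 hinj) ?_
  rintro ⟨a, ha⟩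
  obtain ⟨s, hs⟩ := hsec a ha
  obtain ⟨O, hO, haO, hOopen⟩ :=
    exists_isOpen_of_mem_zariskiNhds (hs.isRegularAt.eventually.and hs.eventually)
  let N : Set (MulAction.orbit (TakiffGroup m r) L) := Subtype.val ⁻¹' O
  have hsN (y : N) := (hO y.2).2 y.1.2
  let sLevel (y : N) : levelSet L := ⟨s y, (hsN y).1⟩
  have hsLevel : IsMorphism ((orbitSpace L).sub N)
      ((affineSpace (PhaseSpace m r)).sub (levelSet L)) sLevel :=
    .of_val_comp ((isSheaf_affineSpace.sub _).sub _) <|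
      ((IsMorphism.val _).comp (.val N)).isRegularAt_comp
        ((isSheaf_affineSpace.sub _).sub _) fun y => (hO y.2).1
  refine ⟨N, haO, ⟨O, hOopen, rfl⟩, fun y => ⟨_, (hD (sLevel y)).2 (hsN y).2.1⟩,
    .of_val_comp ((isSheaf_affineSpace.sub _).sub _) ((IsMorphism.quotientMk _).comp hsLevel),
    fun y => Subtype.ext (hsN y).2.2⟩

theorem isSymplectomorphismOn_of_isLocalSection {D : Set (Reduction L)}
    {U : Set (PhaseSpace m r)} (hU : (affineSpace (PhaseSpace m r)).IsOpen U)
    (hD : ∀ x : levelSet L, Quotient.mk (reductionSetoid L) x ∈ D ↔ x.1 ∈ U)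
    (hnondeg : ∀ x ∈ U, IsNondegeneratePoint x)
    (hinj : ∀ x ∈ U, ∀ y ∈ U, matA x = matA y → ∃ g : TakiffGroup m r, g • y = x)
    (hsec : ∀ a ∈ MulAction.orbit (TakiffGroup m r) L, ∃ s, IsLocalSection L U a s) :
    IsSymplectomorphismOn L D where
  isOpen := ⟨U, hU, Set.ext hD⟩
  nonempty := by
    obtain ⟨s, hs⟩ := hsec L (MulAction.mem_orbit_self L)
    obtain ⟨hsL, hsU, -⟩ :=
      self_mem_of_mem_zariskiNhds hs.eventually (MulAction.mem_orbit_self L)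
    exact ⟨_, (hD ⟨s L, hsL⟩).2 hsU⟩
  mapsTo := by
    rintro ⟨x⟩ hx
    have hA := (hnondeg x ((hD x).1 hx)).matA_mem_orbit
    rwa [x.2] at hA
  isBiregular := isBiregular_reducedMap hD _
    (injOn_reducedMap fun x y hx hy => hinj x ((hD x).1 hx) y ((hD y).1 hy)) hsec
  surjective x hx := (hnondeg x ((hD x).1 hx)).surjective_dMoment
  symplectic x hx := (hnondeg x ((hD x).1 hx)).exists_reducedForm

theorem exists_isRegularAt_conjugator {a : TakiffDual m r}
    (ha : a ∈ MulAction.orbit (TakiffGroup m r) L) :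
    ∃ q : TakiffDual m r → Takiff m r, IsRegularAt q a ∧ ∀ᶠ y in zariskiNhds a, IsUnit (q y) ∧
      (y ∈ MulAction.orbit (TakiffGroup m r) L → SemiconjBy (q y) L.shift y.shift) := by
  obtain ⟨q, hq, hconj⟩ := exists_isRegularAt_semiconjBy (mem_orbit_iff_isConj.1 ha)
  have hshift : IsRegularAt TakiffDual.shift a :=
    isRegularAt_linearMap (shiftEquiv m r).toLinearMap
  refine ⟨fun y => q y.shift, fun l => hshift.comp_mem (hq l), ?_⟩
  filter_upwards [hshift.tendsto hconj] with y hy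
  exact ⟨hy.1, fun hyL => hy.2 (mem_orbit_iff_isConj.1 hyL)⟩

theorem exists_isLocalSection_isUnit_Q {a : TakiffDual m r}
    (ha : a ∈ MulAction.orbit (TakiffGroup m r) L) :
    ∃ s, IsLocalSection L {x | IsUnit x.Q} a s := by
  obtain ⟨q, hq, hconj⟩ := exists_isRegularAt_conjugator ha
  have hinv := hq.ringInverse (self_mem_of_mem_zariskiNhds hconj).1
  refine ⟨fun y => (phaseSpaceEquiv m r).symm (q y, L.shift * Ring.inverse (q y)),
    (hq.prodMk (hinv.linear (LinearMap.mulLeft ℂ L.shift))).linear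
      (phaseSpaceEquiv m r).symm.toLinearMap, ?_⟩
  filter_upwards [hconj] with y ⟨hy, hyL⟩ hyorb
  refine ⟨TakiffDual.shift_injective ?_, hy, TakiffDual.shift_injective ?_⟩
  · rw [shift_momentInner, Q_phaseSpaceEquiv_symm, shift_P_phaseSpaceEquiv_symm,
      Ring.inverse_mul_cancel_right _ _ hy]
  · rw [shift_matA, Q_phaseSpaceEquiv_symm, shift_P_phaseSpaceEquiv_symm, ← mul_assoc,
      (hyL hyorb).eq, Ring.mul_inverse_cancel_right _ _ hy]

theorem exists_isLocalSection_isUnit_shift_P {a : TakiffDual m r}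
    (ha : a ∈ MulAction.orbit (TakiffGroup m r) L) :
    ∃ s, IsLocalSection L {x | IsUnit x.P.shift} a s := by
  obtain ⟨q, hq, hconj⟩ := exists_isRegularAt_conjugator ha
  have hinv := hq.ringInverse (self_mem_of_mem_zariskiNhds hconj).1
  refine ⟨fun y => (phaseSpaceEquiv m r).symm (q y * L.shift, Ring.inverse (q y)),
    ((hq.linear (LinearMap.mulRight ℂ L.shift)).prodMk hinv).linear
      (phaseSpaceEquiv m r).symm.toLinearMap, ?_⟩
  filter_upwards [hconj] with y ⟨hy, hyL⟩ hyorb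
  refine ⟨TakiffDual.shift_injective ?_, ?_, TakiffDual.shift_injective ?_⟩
  · rw [shift_momentInner, Q_phaseSpaceEquiv_symm, shift_P_phaseSpaceEquiv_symm,
      Ring.inverse_mul_cancel_left _ _ hy]
  · exact (shift_P_phaseSpaceEquiv_symm _).symm ▸ hy.ringInverse
  · rw [shift_matA, Q_phaseSpaceEquiv_symm, shift_P_phaseSpaceEquiv_symm, (hyL hyorb).eq,
      Ring.mul_inverse_cancel_right _ _ hy]

theorem mk_mem_domainQ_iff {x : levelSet L} :
    Quotient.mk (reductionSetoid L) x ∈ domainQ L ↔ IsUnit x.1.Q := by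
  rw [Takiff.isUnit_iff]
  refine ⟨?_, fun hx => ⟨x, hx, rfl⟩⟩
  rintro ⟨y, hy, hyx⟩
  obtain ⟨g, hg⟩ : ∃ g : MulAction.stabilizer (TakiffGroup m r) L, g.1 • x.1 = y.1 :=
    Quotient.exact hyx
  rw [Set.mem_ofPred_eq, ← hg, Q_smul, ← Takiff.isUnit_iff, Units.isUnit_mul_units] at hy
  rwa [← Takiff.isUnit_iff]

theorem mk_mem_domainP_iff {x : levelSet L} :
    Quotient.mk (reductionSetoid L) x ∈ domainP L ↔ IsUnit x.1.P.shift := by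
  refine ⟨?_, fun hx => ⟨x, isUnit_shift_iff.1 hx, rfl⟩⟩
  rintro ⟨y, hy, hyx⟩
  obtain ⟨g, hg⟩ : ∃ g : MulAction.stabilizer (TakiffGroup m r) L, g.1 • x.1 = y.1 :=
    Quotient.exact hyx
  rwa [Set.mem_ofPred_eq, ← isUnit_shift_iff, ← hg, shift_P_smul, Units.isUnit_units_mul] at hy

theorem isSymplectomorphismOn_domainQ (L : TakiffDual m r) :
    IsSymplectomorphismOn L (domainQ L) :=
  isSymplectomorphismOn_of_isLocalSection (U := {x | IsUnit x.Q})
    (fun x hx => (isRegularAt_Q x).eventually_isUnit hx) (fun _ => mk_mem_domainQ_iff)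
    (fun _ hx => .inl hx) (fun _ hx _ hy => exists_smul_eq_of_isUnit_Q hx hy)
    fun _ => exists_isLocalSection_isUnit_Q

theorem isSymplectomorphismOn_domainP (L : TakiffDual m r) :
    IsSymplectomorphismOn L (domainP L) :=
  isSymplectomorphismOn_of_isLocalSection (U := {x | IsUnit x.P.shift})
    (fun x hx => (isRegularAt_shift_P x).eventually_isUnit hx) (fun _ => mk_mem_domainP_iff)
    (fun _ hx => .inr hx) (fun _ hx _ hy => exists_smul_eq_of_isUnit_shift_P hx hy)
    fun _ => exists_isLocalSection_isUnit_shift_P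

theorem isUnit_shift_P_and_isUnit_Q (hL : IsUnit (L.coeff (Fin.last r))) (x : levelSet L) :
    IsUnit x.1.P.shift ∧ IsUnit x.1.Q := by
  have : IsArtinianRing (Takiff m r) := .of_finite ℂ _
  rwa [← isUnit_shift_iff, ← x.2, shift_momentInner, IsUnit.mul_iff] at hL

theorem domainQ_eq_univ (hL : IsUnit (L.coeff (Fin.last r))) : domainQ L = Set.univ :=
  Set.eq_univ_of_forall <| Quotient.ind fun x =>
    mk_mem_domainQ_iff.2 (isUnit_shift_P_and_isUnit_Q hL x).2

theorem domainP_eq_univ (hL : IsUnit (L.coeff (Fin.last r))) : domainP L = Set.univ :=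
  Set.eq_univ_of_forall <| Quotient.ind fun x =>
    mk_mem_domainP_iff.2 (isUnit_shift_P_and_isUnit_Q hL x).1

end Reduction

end TakiffReduction

theorem mainTheorem8 (m r : ℕ) :
    InnerActionIsHamiltonian m r ∧
    (∀ (x : PhaseSpace m r) (k : Fin (r + 1)),
      (matA x).coeff k =
        ∑ i : Fin (r - k + 1), x.Q.coeff ⟨i, by omega⟩ * x.P.coeff ⟨i + k, by omega⟩ ∧
      (momentInner x).coeff k =
        ∑ i : Fin (r - k + 1), x.P.coeff ⟨i + k, by omega⟩ * x.Q.coeff ⟨i, by omega⟩) ∧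
    ∀ L : TakiffDual m r,
      IsSymplectomorphismOn L (domainQ L) ∧
      IsSymplectomorphismOn L (domainP L) ∧
      (IsUnit (L.coeff (Fin.last r)) → domainQ L = Set.univ ∧ domainP L = Set.univ) := by
  refine ⟨innerActionIsHamiltonian m r, fun x k => ⟨coeff_matA x k, coeff_momentInner x k⟩,
    fun L => ⟨isSymplectomorphismOn_domainQ L, isSymplectomorphismOn_domainP L, fun hL => ?_⟩⟩
  exact ⟨domainQ_eq_univ hL, domainP_eq_univ hL⟩
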